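/- Let $X$ be a reflexive real Banach space with norm $\|\cdot\|$ such that $X$ and its dual $X^*$ are both locally uniformly convex and the norm of $X$ is Fréchet differentiable at every nonzero point. Let $f:X\to[-\infty,\infty]$, let $\Omega\subset X$ and let $\bar x\in\Omega$ with $f(\bar x)<\infty$. Suppose that (a) $f$ is lower semicontinuous relative to $\Omega$, that is, $\liminf_{u\to x,\,u\in\Omega}f(u)\ge f(x)$ for every $x\in\Omega$ with $f(x)<\infty$; (b) $\Omega$ is locally closed around $\bar x$, that is, $\Omega\cap V$ is closed for some closed neighbourhood $V$ of $\bar x$; (c) $f$ is locally Lipschitz relative to $\Omega$ around $\bar x$, that is, there are $\ell\ge 0$ and a neighbourhood $U$ of $\bar x$ such that $f$ is finite on $U\cap\Omega$ and $|f(x)-f(u)|\le\ell\|x-u\|$ for all $x,u\in U\cap\Omega$. Then $\partial_\Omega f(\bar x)\neq\emptyset$. Here $\partial_\Omega f(\bar x)$, the limiting subdifferential of $f$ at $\bar x$ relative to $\Omega$, is the set of all $x^*\in X^*$ for which there are sequences $\epsilon_k\downarrow 0$ with $\epsilon_k>0$, $x_k\in\Omega$ with $x_k\to\bar x$ and $f(x_k)\to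 f(\bar x)$, and $x_k^*\to x^*$ in the weak$^*$ topology, with $x_k^*\in\widehat\partial^{\epsilon_k}_\Omega f(x_k)$ for all $k$. For $\epsilon\ge0$ and $x\in\Omega$ with $f(x)$ finite, $\widehat\partial^{\epsilon}_\Omega f(x)$ is the set of all $x^*\in X^*$ such that $$\limsup_{\substack{(u,r)\to(x,f(x))\\ u\in\Omega,\ r\in\mathbb R,\ r\ge f(u)}}\frac{\langle x^*,u-x\rangle-(r-f(x))}{\|u-x\|+|r-f(x)|}\le\epsilon$$ (the limit is taken over $(u,r)\ne(x,f(x))$) and $x^*\in J(v)$ for some $v\in T(x,\Omega)$, where $J(v)=\{x^*\in X^*:\langle x^*,v\rangle=\|v\|^2=\|x^*\|^2\}$ and $T(x,\Omega)$ is the set of all $v\in X$ for which there are $t_k>0$ with $t_k\to0$ and $v_k\to v$ with $x+t_kv_k\in\Omega$ for all $k$. Both sets are defined to be empty at points outside $\Omega$ and at points where $f$ is not finite. -/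

import Mathlib

open Filter Topology

noncomputable section

namespace RelSubdiff

/-- A normed space is locally uniformly convex if for every unit vector `x` and every `ε > 0` there
is `δ > 0` such that `‖x + y‖ ≤ 2 - δ` for all unit vectors `y` with `‖x - y‖ ≥ ε`. -/
def LocallyUniformlyConvex (X : Type*) [NormedAddCommGroup X] : Prop :=
  ∀ x : X, ‖x‖ = 1 → ∀ ε : ℝ, 0 < ε →
    ∃ δ : ℝ, 0 < δ ∧ ∀ y : X, ‖y‖ = 1 → ε ≤ ‖x - y‖ → ‖x + y‖ ≤ 2 - δ

/-- Reflexivity: the canonical embedding into the double dual is onto. -/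
def Reflexive (X : Type*) [NormedAddCommGroup X] [NormedSpace ℝ X] : Prop :=
  Function.Surjective (NormedSpace.inclusionInDoubleDual ℝ X)

section Sets

variable {X : Type*} [NormedAddCommGroup X] [NormedSpace ℝ X]

/-- `Ω` is locally closed around `x`: its intersection with some closed neighbourhood of `x`
is closed. -/
def LocallyClosedAround (Ω : Set X) (x : X) : Prop :=
  ∃ V ∈ 𝓝 x, IsClosed V ∧ IsClosed (Ω ∩ V)

/-- The (Bouligand) tangent cone `T(x, Ω)`. -/
def tangentCone (x : X) (Ω : Set X) : Set X :=
  {v | ∃ (t : ℕ → ℝ) (w : ℕ → X), (∀ k, 0 < t k) ∧ Tendsto t atTop (𝓝 0) ∧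
    Tendsto w atTop (𝓝 v) ∧ ∀ k, x + t k • w k ∈ Ω}

/-- The duality mapping `J(x) = {x* | ⟨x*, x⟩ = ‖x‖² = ‖x*‖²}`. -/
def dualityMap (x : X) : Set (StrongDual ℝ X) :=
  {p | p x = ‖x‖ ^ 2 ∧ ‖x‖ ^ 2 = ‖p‖ ^ 2}

/-- The `ε`-normal set to `Ω` at `x`: the upper limit, as `u → x` within `Ω`, `u ≠ x`, of
`⟨p, u - x⟩ / ‖u - x‖` is at most `ε` (the upper limit is taken in `[-∞, ∞]`; it is `-∞` when `x` is
an isolated point of `Ω`). -/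
def epsNormalSet (ε : ℝ) (x : X) (Ω : Set X) : Set (StrongDual ℝ X) :=
  {p | limsup (fun u : X => ((p (u - x) / ‖u - x‖ : ℝ) : EReal)) (𝓝[Ω \ {x}] x) ≤ (ε : EReal)}

/-- The functional `(p, s)` on `X × ℝ`, `(u, r) ↦ ⟨p, u⟩ + s r`, where `X × ℝ` carries the sum norm
`‖(u, r)‖ = ‖u‖ + |r|`. -/
def pairFunctional (p : StrongDual ℝ X) (s : ℝ) : StrongDual ℝ (WithLp 1 (X × ℝ)) :=
  (p.comp (ContinuousLinearMap.fst ℝ X ℝ) + s • ContinuousLinearMap.snd ℝ X ℝ).comp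
    (WithLp.prodContinuousLinearEquiv 1 ℝ X ℝ : WithLp 1 (X × ℝ) →L[ℝ] X × ℝ)

end Sets

section Functions

variable {X : Type*} [NormedAddCommGroup X] [NormedSpace ℝ X]

/-- The effective domain. -/
def dom (f : X → EReal) : Set X := {x | f x < ⊤}

/-- The epigraph, in `X × ℝ` with the sum norm. -/
def epi (f : X → EReal) : Set (WithLp 1 (X × ℝ)) := {z | f z.fst ≤ (z.snd : EReal)}

open Classical in
/-- `f_Ω`: equal to `f` on `Ω` and to `∞` off `Ω`. -/
def restrict (f : X → EReal) (Ω : Set X) : X → EReal := fun x => if x ∈ Ω then f x else ⊤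

/-- `f` is finite at `x`. -/
def FiniteAt (f : X → EReal) (x : X) : Prop := f x ≠ ⊤ ∧ f x ≠ ⊥

/-- `f` is lower semicontinuous relative to `Ω`, i.e. relative to `Ω` at every point of
`Ω ∩ dom f`. -/
def LscRelativeTo (f : X → EReal) (Ω : Set X) : Prop :=
  ∀ x ∈ Ω ∩ dom f, LowerSemicontinuousWithinAt f Ω x

/-- `f` is locally Lipschitz relative to `Ω` around `x`: for some `ℓ ≥ 0` and some neighbourhood `U`
of `x`, `|f u - f v| ≤ ℓ ‖u - v‖` for all `u, v ∈ U ∩ Ω`. With the convention `∞ - ∞ = ∞`, the case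
`u = v` of the inequality says that `f` is finite on `U ∩ Ω`. -/
def LocallyLipschitzRelativeTo (f : X → EReal) (Ω : Set X) (x : X) : Prop :=
  ∃ ℓ : ℝ, 0 ≤ ℓ ∧ ∃ U ∈ 𝓝 x, (∀ u ∈ U ∩ Ω, FiniteAt f u) ∧
    ∀ u ∈ U ∩ Ω, ∀ v ∈ U ∩ Ω, |(f u).toReal - (f v).toReal| ≤ ℓ * ‖u - v‖

/-- The geometric `ε`-subdifferential of `f` at `x`; empty where `f` is not finite. -/
def geomSubdiff (ε : ℝ) (f : X → EReal) (x : X) : Set (StrongDual ℝ X) :=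
  {p | FiniteAt f x ∧
    pairFunctional p (-1) ∈ epsNormalSet ε (WithLp.toLp 1 (x, (f x).toReal)) (epi f)}

/-- The `ε`-regular subdifferential of `f` relative to `Ω` at `x`: the elements of the geometric
`ε`-subdifferential of `f_Ω` that lie in the image `J(T(x, Ω))`; empty if `x ∉ Ω` or if `f` is not
finite at `x`. -/
def regSubdiff (ε : ℝ) (f : X → EReal) (Ω : Set X) (x : X) : Set (StrongDual ℝ X) :=
  {p | x ∈ Ω ∧ FiniteAt f x ∧ p ∈ geomSubdiff ε (restrict f Ω) x ∧
    ∃ v ∈ tangentCone x Ω, p ∈ dualityMap v}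

/-- The limiting subdifferential of `f` relative to `Ω` at `x`: weak* limits of sequences
`p k ∈ regSubdiff (ε k) f Ω (y k)` with `ε k ↓ 0`, `y k → x` in `Ω` and `f (y k) → f x`; empty if
`x ∉ Ω` or if `f` is not finite at `x`. -/
def limSubdiff (f : X → EReal) (Ω : Set X) (x : X) : Set (StrongDual ℝ X) :=
  {q | x ∈ Ω ∧ FiniteAt f x ∧
    ∃ (ε : ℕ → ℝ) (y : ℕ → X) (p : ℕ → StrongDual ℝ X),
      (∀ k, 0 < ε k) ∧ Antitone ε ∧ Tendsto ε atTop (𝓝 0) ∧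
      (∀ k, y k ∈ Ω) ∧ Tendsto y atTop (𝓝 x) ∧ Tendsto (fun k => f (y k)) atTop (𝓝 (f x)) ∧
      Tendsto (fun k => StrongDual.toWeakDual (p k)) atTop (𝓝 (StrongDual.toWeakDual q)) ∧
      ∀ k, p k ∈ regSubdiff (ε k) f Ω (y k)}

end Functions

end RelSubdiff

end

/-!
Near `xbar` the set `Ω` is closed and `f` is a real Lipschitz function `F` on it. Weak* sequential
compactness of bounded sets of functionals (`Reflexive.exists_subseq_tendsto`) and the a priori
bound `norm_le_of_subgradient` reduce the claim to `exists_subgradient_near`: for every `ε > 0`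
there are, arbitrarily near `xbar`, points `z` with an `ε`-subgradient `p ∈ J v`, where `v` is
tangent at `z`.

If the descent slope of `F` is below `ε` somewhere near `xbar`, then `p = 0` and `v = 0` will do.
Otherwise steepest descent is possible everywhere. From a point `y`, Ekeland's principle applied to
`F + a ‖· - y‖`, with `a` slightly below the slope at `y`, gives a point `y'` at which the
functional `p' = a J(y - y') / ‖y - y'‖` is an approximate subgradient (`exists_proxStep`); this
uses that the norm is Fréchet differentiable because the dual is locally uniformly convex. Thus `y`
is seen from `y'` in the direction whose duality image is `p'`. Let such steps be repeated with
rapidly shrinking lengths and tolerances. The points converge to some `z`, and the differences from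
`z` of the points have asymptotically the same directions as the steps. If the functionals converge
in norm to `p`, so do the directions, by local uniform convexity of `X`; hence the vector `v` with
`p ∈ J v` is tangent at `z`, and the inequalities of the individual steps, each of which governs one
range of scales, combine to the subgradient inequality for `p` at `z`
(`exists_tangent_subgradient`).

Norm convergence of the functionals is not automatic and is forced by perturbing `F` by small linear
functionals. Let `N η` be the infimum of the slopes of `F - η` over all states that a descent can
reach. `N` is 1-Lipschitz on the dual, and Ekeland's principle for `N` plus a multiple of a squared
dual norm, which is Fréchet differentiable with derivative in `X` since `X` is reflexive and locally
uniformly convex, gives a perturbation `ξ'` and a vector `w` with `N (ξ' + h) ≥ N ξ' - h w - o(h)`.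
Starting the next steps from a nearly minimal slope, every later functional `p` has norm close to
`N ξ'`, while adding a small multiple of `p` to the perturbation lowers the slope at the
corresponding point by the norm of this multiple. Therefore `p w` is close to `‖p‖`, where `‖w‖` is
at most about one (`Stage.Valid.exists_next`). So all later normalized functionals are nearly normed
by one and the same vector; their weak* cluster points have norm one, and local uniform convexity of
the dual gives norm convergence (`exists_tendsto_of_uniform_pairing`, `exists_descent_sequence`).
-/

namespace RelSubdiff

/-! ### Ekeland's variational principle -/

/-- **Ekeland's variational principle** on a closed subset `K` of a complete metric space. -/
theorem exists_ekeland_point {E : Type*} [MetricSpace E] [CompleteSpace E] {K : Set E}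
    (hK : IsClosed K) {H : E → ℝ} (hH : ContinuousOn H K) {m : ℝ} (hm : ∀ x ∈ K, m ≤ H x)
    {κ : ℝ} (hκ : 0 < κ) {x₀ : E} (hx₀ : x₀ ∈ K) :
    ∃ x ∈ K, H x + κ * dist x x₀ ≤ H x₀ ∧ ∀ u ∈ K, H x ≤ H u + κ * dist u x := by
  -- From `x`, move within `S x` at least half of the way down to the infimum of `H` on `S x`.
  let S : E → Set E := fun x => {u | u ∈ K ∧ H u + κ * dist u x ≤ H x}
  have hstep : ∀ x : K, ∃ y : K, (y : E) ∈ S x ∧ ∀ u ∈ S y, H y - H u ≤ H x - H y := by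
    rintro ⟨x, hx⟩
    have hxS : x ∈ S x := ⟨hx, by simp⟩
    have hbdd : BddBelow (H '' S x) := ⟨m, by rintro _ ⟨u, hu, rfl⟩; exact hm u hu.1⟩
    have htrans : ∀ y ∈ S x, ∀ u ∈ S y, u ∈ S x := fun y hy u hu => ⟨hu.1, by
      have h1 := hu.2
      have h2 := hy.2
      nlinarith [dist_triangle u y x]⟩
    rcases lt_or_ge (sInf (H '' S x)) (H x) with hlt | hge
    · have : sInf (H '' S x) < (H x + sInf (H '' S x)) / 2 := by linarith
      obtain ⟨_, ⟨y, hy, rfl⟩, hyl⟩ := exists_lt_of_csInf_lt (Set.Nonempty.image H ⟨x, hxS⟩) this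
      refine ⟨⟨y, hy.1⟩, hy, fun u hu => ?_⟩
      have : sInf (H '' S x) ≤ H u := csInf_le hbdd ⟨u, htrans y hy u hu, rfl⟩
      simp only
      linarith
    · refine ⟨⟨x, hx⟩, hxS, fun u hu => ?_⟩
      have : sInf (H '' S x) ≤ H u := csInf_le hbdd ⟨u, hu, rfl⟩
      simp only
      linarith
  choose next hnextS hnext using hstep
  let x : ℕ → K := fun n => Nat.rec ⟨x₀, hx₀⟩ (fun _ y => next y) n
  have hx1 : ∀ n : ℕ, (x (n + 1)).1 ∈ S (x n).1 := fun n => hnextS (x n)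
  have hx2 : ∀ n : ℕ, ∀ u ∈ S (x (n + 1)).1, H (x (n + 1)).1 - H u ≤ H (x n).1 - H (x (n + 1)).1 :=
    fun n => hnext (x n)
  have hle : ∀ n k : ℕ, H (x (n + k)).1 + κ * dist (x (n + k)).1 (x n).1 ≤ H (x n).1 := by
    intro n k
    induction k with
    | zero => simp
    | succ k ih =>
      have h1 := (hx1 (n + k)).2
      have h2 := dist_triangle (x (n + k + 1)).1 (x (n + k)).1 (x n).1
      rw [← add_assoc]
      nlinarith
  have hanti : Antitone fun n : ℕ => H (x n).1 := antitone_nat_of_succ_le fun n => by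
    have := hle n 1
    have h2 : 0 ≤ κ * dist (x (n + 1)).1 (x n).1 := by positivity
    linarith
  have hbdd : BddBelow (Set.range fun n : ℕ => H (x n).1) :=
    ⟨m, by rintro _ ⟨n, rfl⟩; exact hm _ (x n).2⟩
  have hlim := tendsto_atTop_ciInf hanti hbdd
  set L := ⨅ n, H (x n).1
  have hcau : CauchySeq fun n : ℕ => (x n).1 := by
    refine Metric.cauchySeq_iff'.2 fun ε hε => ?_
    obtain ⟨N, hN⟩ := ((hlim.eventually (gt_mem_nhds (show L < L + κ * ε by
      have := mul_pos hκ hε; linarith)))).exists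
    refine ⟨N, fun n hn => ?_⟩
    obtain ⟨k, rfl⟩ := Nat.exists_eq_add_of_le hn
    have h1 := hle N k
    have h2 : L ≤ H (x (N + k)).1 := ciInf_le hbdd (N + k)
    exact lt_of_mul_lt_mul_left (by linarith : κ * dist (x (N + k)).1 (x N).1 < κ * ε) hκ.le
  obtain ⟨z, hz⟩ := cauchySeq_tendsto_of_complete hcau
  have hzK : z ∈ K := hK.mem_of_tendsto hz (Eventually.of_forall fun n => (x n).2)
  have hHz : Tendsto (fun n : ℕ => H (x n).1) atTop (𝓝 (H z)) :=
    ((hH z hzK).tendsto).comp (tendsto_nhdsWithin_iff.2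
      ⟨hz, Eventually.of_forall fun n => (x n).2⟩)
  have hzx : ∀ n : ℕ, H z + κ * dist z (x n).1 ≤ H (x n).1 := by
    intro n
    have hsh : Tendsto (fun k : ℕ => n + k) atTop atTop :=
      tendsto_atTop_mono (fun k => Nat.le_add_left k n) tendsto_id
    have h1 : Tendsto (fun k : ℕ => H (x (n + k)).1 + κ * dist (x (n + k)).1 (x n).1) atTop
        (𝓝 (H z + κ * dist z (x n).1)) :=
      (hHz.comp hsh).add (((hz.comp hsh).dist tendsto_const_nhds).const_mul κ)
    exact le_of_tendsto h1 (Eventually.of_forall (hle n))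
  refine ⟨z, hzK, hzx 0, fun u hu => ?_⟩
  by_contra! hlt
  have huS : ∀ n : ℕ, u ∈ S (x n).1 := fun n => ⟨hu, by
    have := hzx n
    nlinarith [dist_triangle u z (x n).1]⟩
  have h1 : Tendsto (fun n => H (x (n + 1)).1 - H u) atTop (𝓝 (H z - H u)) :=
    ((tendsto_add_atTop_iff_nat 1).2 hHz).sub_const _
  have h2 : Tendsto (fun n : ℕ => H (x n).1 - H (x (n + 1)).1) atTop (𝓝 (H z - H z)) :=
    hHz.sub ((tendsto_add_atTop_iff_nat 1).2 hHz)
  have h3 := le_of_tendsto_of_tendsto h1 h2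
    (Eventually.of_forall fun n => hx2 n u (huS (n + 1)))
  have h4 : 0 ≤ κ * dist u z := by positivity
  linarith

/-! ### Locally uniformly convex norms -/

section LocallyUniformlyConvex

variable {Y : Type*} [NormedAddCommGroup Y]

theorem LocallyUniformlyConvex.exists_dist_lt (hY : LocallyUniformlyConvex Y) {x : Y}
    (hx : ‖x‖ = 1) {ε : ℝ} (hε : 0 < ε) :
    ∃ δ : ℝ, 0 < δ ∧ ∀ y : Y, ‖y‖ = 1 → 2 - δ < ‖x + y‖ → ‖x - y‖ < ε := by
  obtain ⟨δ, hδ, h⟩ := hY x hx ε hε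
  refine ⟨δ, hδ, fun y hy hxy => ?_⟩
  by_contra! hge
  exact absurd (h y hy hge) (not_le.2 hxy)

theorem LocallyUniformlyConvex.tendsto (hY : LocallyUniformlyConvex Y) {x : Y}
    (hx : ‖x‖ = 1) {y : ℕ → Y} (hy : ∀ n, ‖y n‖ = 1)
    (h : ∀ δ : ℝ, 0 < δ → ∀ᶠ n in atTop, 2 - δ < ‖x + y n‖) : Tendsto y atTop (𝓝 x) := by
  refine Metric.tendsto_nhds.2 fun ε hε => ?_
  obtain ⟨δ, hδ, hd⟩ := hY.exists_dist_lt hx hε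
  filter_upwards [h δ hδ] with n hn
  rw [dist_comm, dist_eq_norm]
  exact hd _ (hy n) hn

end LocallyUniformlyConvex

section Duality

variable {X : Type*} [NormedAddCommGroup X] [NormedSpace ℝ X]

theorem apply_le_norm_of_norm_eq_one {e : StrongDual ℝ X} (he : ‖e‖ = 1) (x : X) : e x ≤ ‖x‖ := by
  have := (le_abs_self _).trans (e.le_opNorm x)
  rwa [he, one_mul] at this

theorem apply_le_opNorm (e : StrongDual ℝ X) (x : X) : e x ≤ ‖e‖ * ‖x‖ :=
  (le_abs_self _).trans (e.le_opNorm x)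

theorem neg_le_apply (e : StrongDual ℝ X) (x : X) : -(‖e‖ * ‖x‖) ≤ e x :=
  neg_le_of_abs_le (e.le_opNorm x)

/-- In a reflexive space every functional attains its norm. -/
theorem Reflexive.exists_norming (hX : Reflexive X) (e : StrongDual ℝ X) (he : e ≠ 0) :
    ∃ x : X, ‖x‖ = 1 ∧ e x = ‖e‖ := by
  obtain ⟨g, hg, hge⟩ := exists_dual_vector ℝ e (norm_ne_zero_iff.2 he)
  obtain ⟨x, rfl⟩ := hX g
  exact ⟨x, by rwa [← (NormedSpace.inclusionInDoubleDualLi (E := X) ℝ).norm_map x],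
    by simpa using hge⟩

/-- If the dual norm is locally uniformly convex, then at a unit vector `d` normed by the unit
functional `e` the norm has derivative `e`, uniformly for base points near `d`. -/
theorem exists_norm_sub_le (hX' : LocallyUniformlyConvex (StrongDual ℝ X)) {d : X} (hd : ‖d‖ = 1)
    {e : StrongDual ℝ X} (he : ‖e‖ = 1) (hed : e d = 1) {ε : ℝ} (hε : 0 < ε) :
    ∃ τ : ℝ, 0 < τ ∧ ∀ y h : X, ‖y - d‖ ≤ τ → ‖h‖ ≤ τ → ‖y - h‖ ≤ ‖y‖ - e h + ε * ‖h‖ := by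
  obtain ⟨δ, hδ, hconv⟩ := hX'.exists_dist_lt he hε
  refine ⟨min (δ / 8) (1 / 4), by positivity, fun y h hy hh => ?_⟩
  have hy1 := hy.trans (min_le_left _ _)
  have hy2 := hy.trans (min_le_right _ _)
  have hh1 := hh.trans (min_le_left _ _)
  have hh2 := hh.trans (min_le_right _ _)
  have hdist : ‖d - (y - h)‖ ≤ ‖y - d‖ + ‖h‖ := by
    have : d - (y - h) = h - (y - d) := by abel
    rw [this, add_comm]
    exact norm_sub_le _ _
  have hnorm : 1 - ‖d - (y - h)‖ ≤ ‖y - h‖ := by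
    have := norm_sub_norm_le d (y - h)
    linarith
  obtain ⟨e', he', hex⟩ := exists_dual_vector ℝ (y - h) (by linarith)
  have hex : e' (y - h) = ‖y - h‖ := by simpa using hex
  have hsum : 2 - δ < ‖e + e'‖ := by
    have h1 : (e + e') d ≤ ‖e + e'‖ := by
      simpa [hd] using apply_le_opNorm (e + e') d
    have h2 : e' d = e' (y - h) + e' (d - (y - h)) := by rw [← map_add]; congr 1; abel
    have h3 := neg_le_apply e' (d - (y - h))
    rw [he', one_mul] at h3
    rw [add_apply, hed] at h1
    linarith
  have hclose := hconv e' he' hsum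
  have h1 : e' y ≤ ‖y‖ := apply_le_norm_of_norm_eq_one he' y
  have h2 : (e - e') h ≤ ε * ‖h‖ :=
    (apply_le_opNorm _ _).trans (mul_le_mul_of_nonneg_right hclose.le (norm_nonneg _))
  rw [sub_apply] at h2
  rw [map_sub] at hex
  linarith

/-- If `X` is reflexive and locally uniformly convex, then the dual norm is Fréchet differentiable
off the origin, with derivative in `X`. -/
theorem exists_dual_norm_add_le (hrefl : Reflexive X) (hX : LocallyUniformlyConvex X)
    {ζ : StrongDual ℝ X} (hζ : ζ ≠ 0) {ε : ℝ} (hε : 0 < ε) :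
    ∃ w : X, ∃ ϱ : ℝ, 0 < ϱ ∧ ∀ h : StrongDual ℝ X, ‖h‖ ≤ ϱ → ‖ζ + h‖ ≤ ‖ζ‖ + h w + ε * ‖h‖ := by
  obtain ⟨w, hw, hζw⟩ := hrefl.exists_norming ζ hζ
  obtain ⟨δ, hδ, hconv⟩ := hX.exists_dist_lt hw hε
  have hζ0 : 0 < ‖ζ‖ := norm_pos_iff.2 hζ
  refine ⟨w, min (δ / 4 * ‖ζ‖) (‖ζ‖ / 2), by positivity, fun h hh => ?_⟩
  have hh1 := hh.trans (min_le_left _ _)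
  have hh2 := hh.trans (min_le_right _ _)
  have hne : ζ + h ≠ 0 := by
    intro h0
    have : ‖ζ‖ = ‖h‖ := by rw [eq_neg_of_add_eq_zero_left h0, norm_neg]
    linarith
  obtain ⟨x, hx, hζx⟩ := hrefl.exists_norming (ζ + h) hne
  have h1 : ‖ζ‖ - ‖h‖ ≤ ‖ζ + h‖ := norm_sub_le_norm_add ζ h
  have h2 : h x ≤ ‖h‖ := by simpa [hx] using apply_le_opNorm h x
  rw [add_apply] at hζx
  have h3 : ζ (w + x) ≤ ‖ζ‖ * ‖w + x‖ := apply_le_opNorm _ _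
  rw [map_add, hζw] at h3
  have hsum : 2 - δ < ‖w + x‖ := by
    refine lt_of_mul_lt_mul_left ?_ hζ0.le
    nlinarith [mul_pos hδ hζ0]
  have hclose := hconv x hx hsum
  have h4 : ζ x ≤ ‖ζ‖ := by simpa [hx] using apply_le_opNorm ζ x
  have h5 : -(‖h‖ * ‖w - x‖) ≤ h (w - x) := neg_le_apply _ _
  have h6 : ‖h‖ * ‖w - x‖ ≤ ‖h‖ * ε := mul_le_mul_of_nonneg_left hclose.le (norm_nonneg _)
  rw [map_sub] at h5
  linarith

/-- Fréchet smoothness of the squared dual norm, with derivative in `X`. -/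
theorem exists_dual_norm_sq_add_le (hrefl : Reflexive X) (hX : LocallyUniformlyConvex X)
    (ζ : StrongDual ℝ X) {M : ℝ} (hM : 0 < M) {ε : ℝ} (hε : 0 < ε) :
    ∃ w : X, ∃ ϱ : ℝ, 0 < ϱ ∧
      ∀ h : StrongDual ℝ X, ‖h‖ ≤ ϱ → M * ‖ζ + h‖ ^ 2 ≤ M * ‖ζ‖ ^ 2 + h w + ε * ‖h‖ := by
  rcases eq_or_ne ζ 0 with rfl | hζ
  · refine ⟨0, ε / M, by positivity, fun h hh => ?_⟩
    have h1 : M * ‖h‖ ≤ ε := by rwa [le_div_iff₀ hM, mul_comm] at hh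
    have := mul_le_mul_of_nonneg_right h1 (norm_nonneg h)
    simp only [zero_add, norm_zero, map_zero]
    nlinarith
  · have hζ0 : 0 < ‖ζ‖ := norm_pos_iff.2 hζ
    obtain ⟨w, ϱ, hϱ, hw⟩ := exists_dual_norm_add_le hrefl hX hζ
      (show 0 < ε / (4 * M * ‖ζ‖) by positivity)
    refine ⟨(2 * M * ‖ζ‖) • w, min ϱ (ε / (2 * M)), by positivity, fun h hh => ?_⟩
    have h1 := hw h (hh.trans (min_le_left _ _))
    have h2 : M * ‖h‖ ≤ ε / 2 := by
      have := hh.trans (min_le_right _ _)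
      rw [le_div_iff₀ (by positivity)] at this
      linarith
    have h3 : |‖ζ + h‖ - ‖ζ‖| ≤ ‖h‖ := by
      simpa using abs_norm_sub_norm_le (ζ + h) ζ
    have h4 : (‖ζ + h‖ - ‖ζ‖) ^ 2 ≤ ‖h‖ ^ 2 := sq_le_sq' (abs_le.1 h3).1 (abs_le.1 h3).2
    have h5 : 2 * M * ‖ζ‖ * (‖ζ + h‖ - ‖ζ‖) ≤ 2 * M * ‖ζ‖ * (h w + ε / (4 * M * ‖ζ‖) * ‖h‖) :=
      mul_le_mul_of_nonneg_left (by linarith) (by positivity)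
    have h6 : 2 * M * ‖ζ‖ * (ε / (4 * M * ‖ζ‖) * ‖h‖) = ε / 2 * ‖h‖ := by
      field_simp
      norm_num
    have h7 := mul_le_mul_of_nonneg_right h2 (norm_nonneg h)
    have h8 := mul_le_mul_of_nonneg_left h4 hM.le
    rw [map_smul, smul_eq_mul]
    nlinarith

/-! ### Compactness in the dual of a reflexive space -/

theorem isCompact_preimage_toStrongDual_closedBall (M : ℝ) :
    IsCompact (WeakDual.toStrongDual ⁻¹' Metric.closedBall (0 : StrongDual ℝ X) M) :=
  WeakDual.isCompact_closedBall 0 M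

/-- If every `e i` has norm one and for each `δ > 0` there is a vector of norm at most `1 + δ` on
which the `e i` eventually exceed `1 - δ`, then every weak* cluster point has norm one, and local
uniform convexity turns weak* clustering into norm convergence. -/
theorem exists_tendsto_of_uniform_pairing (hX' : LocallyUniformlyConvex (StrongDual ℝ X))
    {e : ℕ → StrongDual ℝ X} (he : ∀ i, ‖e i‖ = 1)
    (h : ∀ δ : ℝ, 0 < δ → ∃ w : X, ‖w‖ ≤ 1 + δ ∧ ∀ᶠ i in atTop, 1 - δ ≤ e i w) :
    ∃ e' : StrongDual ℝ X, ‖e'‖ = 1 ∧ Tendsto e atTop (𝓝 e') := by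
  obtain ⟨a, ha, hcl⟩ := (isCompact_preimage_toStrongDual_closedBall (X := X) 1).exists_mapClusterPt
    (f := atTop) (u := fun i => StrongDual.toWeakDual (e i))
    (tendsto_principal.2 (Eventually.of_forall fun i => by simp [he i]))
  set e' : StrongDual ℝ X := WeakDual.toStrongDual a
  have he'1 : ‖e'‖ ≤ 1 := by simpa [e'] using ha
  have hpair : ∀ δ : ℝ, 0 < δ → ∃ w : X, ‖w‖ ≤ 1 + δ ∧ (∀ᶠ i in atTop, 1 - δ ≤ e i w) ∧
      1 - δ ≤ e' w := by
    intro δ hδ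
    obtain ⟨w, hw, hev⟩ := h δ hδ
    refine ⟨w, hw, hev, ?_⟩
    have hcont : ContinuousAt (fun φ : WeakDual ℝ X => φ w) a :=
      (WeakDual.eval_continuous w).continuousAt
    have hcl' := hcl.continuousAt_comp hcont
    exact isClosed_Ici.mem_of_mapClusterPt hcl' hev
  have he' : ‖e'‖ = 1 := by
    refine le_antisymm he'1 (le_of_forall_pos_le_add fun δ hδ => ?_)
    obtain ⟨w, hw, -, hw'⟩ := hpair (δ / 2) (by positivity)
    have h1 := apply_le_opNorm e' w
    have h2 : ‖e'‖ * ‖w‖ ≤ ‖e'‖ * (1 + δ / 2) := mul_le_mul_of_nonneg_left hw (norm_nonneg _)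
    nlinarith
  refine ⟨e', he', hX'.tendsto he' he fun δ hδ => ?_⟩
  obtain ⟨w, hw, hev, hw'⟩ := hpair (min (δ / 8) 1) (by positivity)
  filter_upwards [hev] with i hi
  have hm1 := min_le_left (δ / 8) 1
  have hm2 : 0 < min (δ / 8) 1 := by positivity
  set m := min (δ / 8) 1
  have h1 := apply_le_opNorm (e' + e i) w
  have h2 : ‖e' + e i‖ * ‖w‖ ≤ ‖e' + e i‖ * (1 + m) := mul_le_mul_of_nonneg_left hw (norm_nonneg _)
  have h3 : ‖e' + e i‖ ≤ 2 := (norm_add_le _ _).trans (by rw [he', he i]; norm_num)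
  rw [add_apply] at h1
  nlinarith

/-- Weak* sequential compactness of bounded sets in the dual of a reflexive space. -/
theorem Reflexive.exists_subseq_tendsto (hX : Reflexive X) {p : ℕ → StrongDual ℝ X} {M : ℝ}
    (hM : ∀ k, ‖p k‖ ≤ M) : ∃ (q : StrongDual ℝ X) (φ : ℕ → ℕ), StrictMono φ ∧
      Tendsto (fun k => StrongDual.toWeakDual (p (φ k))) atTop (𝓝 (StrongDual.toWeakDual q)) := by
  have hM0 : 0 ≤ M := (norm_nonneg _).trans (hM 0)
  -- `Z` is separable, so countably many vectors norm a dense subset of it.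
  set Z : Submodule ℝ (StrongDual ℝ X) := (Submodule.span ℝ (Set.range p)).topologicalClosure
  have hZsep : TopologicalSpace.IsSeparable (Z : Set (StrongDual ℝ X)) := by
    rw [Submodule.topologicalClosure_coe]
    exact ((Set.countable_range p).isSeparable.span (R := ℝ)).closure
  obtain ⟨A, hA, hZA⟩ := hZsep
  have hD : ∀ a : StrongDual ℝ X, ∃ x : X, ‖x‖ ≤ 1 ∧ a x = ‖a‖ := by
    intro a
    rcases eq_or_ne a 0 with rfl | ha
    · exact ⟨0, by simp, by simp⟩
    · obtain ⟨x, hx, hax⟩ := hX.exists_norming a ha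
      exact ⟨x, hx.le, hax⟩
  choose D hD1 hD2 using hD
  have : Countable A := hA
  obtain ⟨g, -, φ, hφ, hg⟩ :=
    (isCompact_univ_pi fun _ : A => isCompact_closedBall (0 : ℝ) M).isSeqCompact
      (x := fun k (a : A) => p k (D a)) (fun k a _ => by
        rw [mem_closedBall_zero_iff]
        refine ((p k).le_opNorm _).trans ?_
        have := mul_le_mul (hM k) (hD1 a) (norm_nonneg _) hM0
        linarith)
  have hg' : ∀ a : A, Tendsto (fun k => p (φ k) (D a)) atTop (𝓝 (g a)) := fun a =>
    (tendsto_pi_nhds.1 hg) a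
  have hK := isCompact_preimage_toStrongDual_closedBall (X := X) M
  have hmem : ∀ k, StrongDual.toWeakDual (p (φ k)) ∈
      WeakDual.toStrongDual ⁻¹' Metric.closedBall (0 : StrongDual ℝ X) M := fun k => by
    simpa using hM (φ k)
  have hclA : ∀ b : WeakDual ℝ X,
      MapClusterPt b atTop (fun k => StrongDual.toWeakDual (p (φ k))) → ∀ a : A, b (D a) = g a := by
    intro b hb a
    have hcl := hb.continuousAt_comp (WeakDual.eval_continuous (D a)).continuousAt
    by_contra hne
    exact (hcl.clusterPt.mono (hg' a)).neBot.ne ((disjoint_nhds_nhds.2 hne).eq_bot)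
  -- By reflexivity the norm closed subspace `Z` is weak* closed.
  have hclZ : ∀ b : WeakDual ℝ X,
      MapClusterPt b atTop (fun k => StrongDual.toWeakDual (p (φ k))) →
        WeakDual.toStrongDual b ∈ Z := by
    intro b hb
    by_contra hbZ
    obtain ⟨Φ, u, hlt, hub⟩ := geometric_hahn_banach_closed_point Z.convex
      (Submodule.isClosed_topologicalClosure _) hbZ
    have hΦ : ∀ z ∈ Z, Φ z = 0 := by
      intro z hz
      by_contra hne
      have h1 := hlt (((|u| + 1) / Φ z) • z) (Z.smul_mem _ hz)
      rw [map_smul, smul_eq_mul, div_mul_cancel₀ _ hne] at h1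
      linarith [le_abs_self u]
    have hu : 0 < u := by simpa using hlt 0 Z.zero_mem
    obtain ⟨x, rfl⟩ := hX Φ
    have hcl := hb.continuousAt_comp (WeakDual.eval_continuous x).continuousAt
    have hpx : ∀ k, p (φ k) x = 0 := fun k =>
      hΦ _ (Submodule.le_topologicalClosure _ (Submodule.subset_span ⟨_, rfl⟩))
    have : b x ∈ ({0} : Set ℝ) := isClosed_singleton.mem_of_mapClusterPt hcl
      (Eventually.of_forall fun k => hpx k)
    have hbx : u < b x := hub
    rw [Set.mem_singleton_iff] at this
    linarith
  obtain ⟨b, -, hb⟩ := hK.exists_mapClusterPt (f := atTop)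
    (tendsto_principal.2 (Eventually.of_forall hmem))
  refine ⟨WeakDual.toStrongDual b, φ, hφ, ?_⟩
  refine hK.tendsto_nhds_of_unique_mapClusterPt (Eventually.of_forall hmem) fun b' _ hb' => ?_
  -- Two cluster points differ by an element of `Z` that vanishes on vectors norming a dense subset.
  set z : StrongDual ℝ X := WeakDual.toStrongDual b' - WeakDual.toStrongDual b
  have hz : z ∈ Z := Z.sub_mem (hclZ b' hb') (hclZ b hb)
  have hzD : ∀ a : A, z (D a) = 0 := fun a => by
    have h1 : b' (D a) - b (D a) = 0 := by rw [hclA b' hb' a, hclA b hb a, sub_self]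
    exact h1
  have hz0 : z = 0 := by
    rw [← norm_le_zero_iff]
    refine le_of_forall_pos_le_add fun ε hε => ?_
    obtain ⟨a, ha, hza⟩ := Metric.mem_closure_iff.1 (hZA hz) (ε / 2) (by positivity)
    rw [dist_eq_norm] at hza
    have h1 : ‖a‖ ≤ ‖z - a‖ := by
      have h2 := neg_le_apply (z - a) (D a)
      have h3 : (z - a) (D a) = -‖a‖ := by
        rw [sub_apply, hzD ⟨a, ha⟩, hD2, zero_sub]
      have h4 : ‖z - a‖ * ‖D a‖ ≤ ‖z - a‖ * 1 :=
        mul_le_mul_of_nonneg_left (hD1 a) (norm_nonneg _)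
      linarith
    have h5 : ‖z‖ ≤ ‖z - a‖ + ‖a‖ := by simpa using norm_add_le (z - a) a
    linarith
  have h1 : WeakDual.toStrongDual b' = WeakDual.toStrongDual b := sub_eq_zero.1 hz0
  have h2 := congrArg StrongDual.toWeakDual h1
  simpa using h2

end Duality

section LipschitzBoundOn

variable {X : Type*} [NormedAddCommGroup X]

/-- `F` is Lipschitz on `C` with constant `ℓ`. -/
def LipschitzBoundOn (ℓ : ℝ) (F : X → ℝ) (C : Set X) : Prop :=
  ∀ u ∈ C, ∀ v ∈ C, |F u - F v| ≤ ℓ * ‖u - v‖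

variable {F : X → ℝ} {C : Set X} {ℓ : ℝ}

theorem LipschitzBoundOn.sub_le (hF : LipschitzBoundOn ℓ F C) {u v : X} (hu : u ∈ C) (hv : v ∈ C) :
    F u - F v ≤ ℓ * ‖u - v‖ :=
  (le_abs_self _).trans (hF u hu v hv)

theorem LipschitzBoundOn.continuousOn (hF : LipschitzBoundOn ℓ F C) : ContinuousOn F C := by
  refine (LipschitzOnWith.of_dist_le_mul (K := ℓ.toNNReal) fun u hu v hv => ?_).continuousOn
  rw [Real.dist_eq, dist_eq_norm]
  exact (hF u hu v hv).trans (mul_le_mul_of_nonneg_right (Real.le_coe_toNNReal ℓ) (norm_nonneg _))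

end LipschitzBoundOn

section DescentSlope

variable {X : Type*} [NormedAddCommGroup X] [NormedSpace ℝ X]

/-! ### The descent slope -/

/-- `a ≥ 0` bounds the rate at which `F - ξ` decreases on `C` near `z`. -/
def HasSlopeBound (F : X → ℝ) (C : Set X) (ξ : StrongDual ℝ X) (z : X) (a : ℝ) : Prop :=
  0 ≤ a ∧ ∃ r : ℝ, 0 < r ∧ ∀ u ∈ C, ‖u - z‖ < r → F z - F u - ξ (z - u) ≤ a * ‖u - z‖

/-- The descent slope at `z` of `F - ξ` restricted to `C`, that is, the upper limit of
`((F - ξ) z - (F - ξ) u)⁺ / ‖u - z‖` as `u → z` in `C`. It is written as the infimum of the local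
bounds, a nonempty set when `F` is Lipschitz on `C`. -/
noncomputable def descentSlope (F : X → ℝ) (C : Set X) (ξ : StrongDual ℝ X) (z : X) : ℝ :=
  sInf {a | HasSlopeBound F C ξ z a}

variable {F : X → ℝ} {C : Set X} {ξ h : StrongDual ℝ X} {z : X} {a ℓ : ℝ}

theorem bddBelow_hasSlopeBound : BddBelow {a | HasSlopeBound F C ξ z a} := ⟨0, fun _ h => h.1⟩

theorem descentSlope_nonneg : 0 ≤ descentSlope F C ξ z := Real.sInf_nonneg fun _ h => h.1

theorem HasSlopeBound.descentSlope_le (ha : HasSlopeBound F C ξ z a) : descentSlope F C ξ z ≤ a :=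
  csInf_le bddBelow_hasSlopeBound ha

theorem HasSlopeBound.mono {b : ℝ} (ha : HasSlopeBound F C ξ z a) (hab : a ≤ b) :
    HasSlopeBound F C ξ z b := by
  obtain ⟨h0, r, hr, h⟩ := ha
  exact ⟨h0.trans hab, r, hr, fun u hu hur =>
    (h u hu hur).trans (mul_le_mul_of_nonneg_right hab (norm_nonneg _))⟩

theorem LipschitzBoundOn.hasSlopeBound (hF : LipschitzBoundOn ℓ F C) (hz : z ∈ C)
    (ξ : StrongDual ℝ X) : HasSlopeBound F C ξ z (|ℓ| + ‖ξ‖) := by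
  refine ⟨by positivity, 1, one_pos, fun u hu _ => ?_⟩
  have h1 := hF.sub_le hz hu
  have h2 := neg_le_apply ξ (z - u)
  have h3 := mul_le_mul_of_nonneg_right (le_abs_self ℓ) (norm_nonneg (z - u))
  rw [norm_sub_rev u z]
  linarith

theorem LipschitzBoundOn.hasSlopeBound_of_lt (hF : LipschitzBoundOn ℓ F C) (hz : z ∈ C)
    (h : descentSlope F C ξ z < a) : HasSlopeBound F C ξ z a := by
  obtain ⟨b, hb, hba⟩ := exists_lt_of_csInf_lt (s := {a | HasSlopeBound F C ξ z a})
    ⟨_, hF.hasSlopeBound hz ξ⟩ h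
  exact HasSlopeBound.mono hb hba.le

theorem exists_drop_of_lt_descentSlope (ha0 : 0 ≤ a) (ha : a < descentSlope F C ξ z) {r : ℝ}
    (hr : 0 < r) : ∃ u ∈ C, ‖u - z‖ < r ∧ a * ‖u - z‖ < F z - F u - ξ (z - u) := by
  by_contra! hcon
  exact absurd (HasSlopeBound.descentSlope_le ⟨ha0, r, hr, hcon⟩) (not_le.2 ha)

theorem LipschitzBoundOn.descentSlope_add_le (hF : LipschitzBoundOn ℓ F C) (hz : z ∈ C)
    (ξ h : StrongDual ℝ X) : descentSlope F C (ξ + h) z ≤ descentSlope F C ξ z + ‖h‖ := by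
  refine le_of_forall_pos_le_add fun ε hε => ?_
  obtain ⟨h0, r, hr, hb⟩ := hF.hasSlopeBound_of_lt hz (lt_add_of_pos_right _ hε :
    descentSlope F C ξ z < _ + ε)
  refine HasSlopeBound.descentSlope_le ⟨by linarith [norm_nonneg h], r, hr, fun u hu hur => ?_⟩
  have h1 := hb u hu hur
  have h2 := neg_le_apply h (z - u)
  rw [add_apply]
  rw [norm_sub_rev z u] at h2
  linarith

theorem LipschitzBoundOn.descentSlope_le_add (hF : LipschitzBoundOn ℓ F C) (hz : z ∈ C)
    (ξ ξ' : StrongDual ℝ X) : descentSlope F C ξ z ≤ descentSlope F C ξ' z + ‖ξ - ξ'‖ := by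
  simpa using hF.descentSlope_add_le hz ξ' (ξ - ξ')

/-! ### Proximal steps -/

/-- The current point of the descent, the radius within which all later points stay, and the
functional obtained in the step that led to the point. -/
structure ProxState (X : Type*) [NormedAddCommGroup X] [NormedSpace ℝ X] where
  /-- the current point -/
  pt : X
  /-- the scale of the next step -/
  radius : ℝ
  /-- the approximate subgradient at `pt` -/
  grad : StrongDual ℝ X

/-- One step of steepest descent for `F - ξ` on `C`, with tolerance `τ`. The functional
`σ'.grad` is the duality image of a multiple of `σ.pt - σ'.pt`; the new point nearly minimizes
`F - ξ + ‖σ'.grad‖ * ‖· - σ.pt‖`, so `σ'.grad` is a `τ`-subgradient within `σ'.radius`, while the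
unlinearized inequality `far` holds up to the scale of the step. -/
structure ProxStep (F : X → ℝ) (C : Set X) (ξ : StrongDual ℝ X) (τ c : ℝ) (σ σ' : ProxState X) :
    Prop where
  radius_pos : 0 < σ.radius
  radius_pos' : 0 < σ'.radius
  mem : σ'.pt ∈ C
  ne : σ'.pt ≠ σ.pt
  dist_le : ‖σ'.pt - σ.pt‖ ≤ τ * σ.radius
  radius_le : σ'.radius ≤ τ * ‖σ'.pt - σ.pt‖
  norm_le : ‖σ'.grad‖ ≤ c
  grad_apply : σ'.grad (σ.pt - σ'.pt) = ‖σ'.grad‖ * ‖σ'.pt - σ.pt‖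
  drop : (‖σ'.grad‖ - τ) * ‖σ'.pt - σ.pt‖ ≤ F σ.pt - F σ'.pt - ξ (σ.pt - σ'.pt)
  far : ∀ u ∈ C, ‖u - σ'.pt‖ ≤ ‖σ'.pt - σ.pt‖ →
    ‖σ'.grad‖ * (‖σ'.pt - σ.pt‖ - ‖u - σ.pt‖) - τ * ‖u - σ'.pt‖ ≤ F u - F σ'.pt - ξ (u - σ'.pt)
  near : ∀ u ∈ C, ‖u - σ'.pt‖ ≤ σ'.radius →
    σ'.grad (u - σ'.pt) - τ * ‖u - σ'.pt‖ ≤ F u - F σ'.pt - ξ (u - σ'.pt)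

variable {σ σ' : ProxState X} {τ τ' c c' : ℝ} {ξ' : StrongDual ℝ X}

theorem ProxStep.mono (hs : ProxStep F C ξ' τ' c' σ σ') (hτ : ‖ξ' - ξ‖ + τ' ≤ τ) (hc : c' ≤ c) :
    ProxStep F C ξ τ c σ σ' := by
  have hττ : τ' ≤ τ := by linarith [norm_nonneg (ξ' - ξ)]
  have key : ∀ w : X, -(τ - τ') * ‖w‖ ≤ ξ' w - ξ w := fun w => by
    have h1 := neg_le_apply (ξ' - ξ) w
    rw [sub_apply] at h1
    have h2 := mul_le_mul_of_nonneg_right (show ‖ξ' - ξ‖ ≤ τ - τ' by linarith) (norm_nonneg w)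
    linarith
  refine ⟨hs.radius_pos, hs.radius_pos', hs.mem, hs.ne, ?_, ?_, hs.norm_le.trans hc, hs.grad_apply,
    ?_, fun u hu hur => ?_, fun u hu hur => ?_⟩
  · exact hs.dist_le.trans (mul_le_mul_of_nonneg_right hττ hs.radius_pos.le)
  · exact hs.radius_le.trans (mul_le_mul_of_nonneg_right hττ (norm_nonneg _))
  · have h1 := hs.drop
    have h2 := key (σ.pt - σ'.pt)
    rw [norm_sub_rev σ.pt] at h2
    linarith
  · have h1 := hs.far u hu hur
    have h2 := key (u - σ'.pt)
    linarith
  · have h1 := hs.near u hu hur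
    have h2 := key (u - σ'.pt)
    linarith

theorem ProxStep.norm_sub_pos (hs : ProxStep F C ξ τ c σ σ') : 0 < ‖σ'.pt - σ.pt‖ :=
  norm_pos_iff.2 (sub_ne_zero.2 hs.ne)

theorem ProxStep.tol_pos (hs : ProxStep F C ξ τ c σ σ') : 0 < τ :=
  pos_of_mul_pos_left (hs.norm_sub_pos.trans_le hs.dist_le) hs.radius_pos.le

/-- Subtracting `h` from `F - ξ` changes the new functional to `σ'.grad - h`. -/
theorem ProxStep.descentSlope_le (hs : ProxStep F C ξ τ c σ σ') (h : StrongDual ℝ X) :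
    descentSlope F C (ξ + h) σ'.pt ≤ ‖σ'.grad - h‖ + τ := by
  refine HasSlopeBound.descentSlope_le
    ⟨add_nonneg (norm_nonneg _) hs.tol_pos.le, σ'.radius, hs.radius_pos', fun u hu hur => ?_⟩
  have h1 := hs.near u hu hur.le
  have h2 := neg_le_apply (σ'.grad - h) (u - σ'.pt)
  have h3 : ξ (σ'.pt - u) = -ξ (u - σ'.pt) := by rw [← map_neg, neg_sub]
  have h4 : h (σ'.pt - u) = -h (u - σ'.pt) := by rw [← map_neg, neg_sub]
  rw [sub_apply] at h2
  rw [add_apply, h3, h4]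
  linarith

/-- Steepest descent is possible wherever the descent slope is positive. Ekeland's principle is
applied to `F - ξ + a‖· - z‖` with `a` slightly below the slope at `z`; since the slope is only
slightly above `a`, the Ekeland point cannot be far away from the starting point `u₀`. -/
theorem exists_proxStep [CompleteSpace X] (hX' : LocallyUniformlyConvex (StrongDual ℝ X))
    (hC : IsClosed C) (hF : LipschitzBoundOn ℓ F C) (hz : σ.pt ∈ C) (hρ : 0 < σ.radius)
    (hs : 0 < descentSlope F C ξ σ.pt) (hc : descentSlope F C ξ σ.pt < c) (hτ : 0 < τ) :
    ∃ σ', ProxStep F C ξ τ c σ σ' ∧ descentSlope F C ξ σ'.pt < c := by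
  set s := descentSlope F C ξ σ.pt
  set z := σ.pt
  obtain ⟨η, hη, hηs, hητ, hηc⟩ : ∃ η : ℝ, 0 < η ∧ η ≤ s / 2 ∧ η ≤ τ / 5 ∧ η ≤ (c - s) / 5 :=
    ⟨min (s / 2) (min (τ / 5) ((c - s) / 5)), by
      have : 0 < c - s := by linarith
      positivity, min_le_left _ _, (min_le_right _ _).trans (min_le_left _ _),
      (min_le_right _ _).trans (min_le_right _ _)⟩
  set a := s - η with ha
  have ha0 : 0 < a := by linarith
  obtain ⟨-, r, hr, hbound⟩ := hF.hasSlopeBound_of_lt hz (show s < a + 2 * η by linarith)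
  set r₀ := r / 2 with hr₀
  have hr₀0 : 0 < r₀ := by positivity
  obtain ⟨u₀, hu₀C, hu₀r, hu₀⟩ := exists_drop_of_lt_descentSlope (F := F) (C := C) (ξ := ξ) ha0.le
    (show a < s by linarith) (show 0 < min (τ * σ.radius / 2) (r₀ / 4) by positivity)
  have hu₀r1 := hu₀r.trans_le (min_le_left _ _)
  have hu₀r2 := hu₀r.trans_le (min_le_right _ _)
  set K := C ∩ Metric.closedBall z r₀
  have hKr : ∀ u ∈ K, ‖u - z‖ ≤ r₀ := fun u hu => by
    simpa [dist_eq_norm] using hu.2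
  set H : X → ℝ := fun u => F u - ξ u + a * ‖u - z‖ with hH
  have hHcont : ContinuousOn H K := by
    refine ContinuousOn.add (ContinuousOn.sub (hF.continuousOn.mono Set.inter_subset_left) ?_) ?_
    · exact ξ.continuous.continuousOn
    · fun_prop
  have hlow : ∀ u ∈ K, F z - ξ z - 2 * η * ‖u - z‖ ≤ H u := fun u hu => by
    have h1 := hbound u hu.1 ((hKr u hu).trans_lt (by linarith))
    rw [map_sub] at h1
    simp only [hH]
    linarith
  obtain ⟨x, hxK, hx1, hx2⟩ := exists_ekeland_point (hC.inter Metric.isClosed_closedBall) hHcont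
    (m := F z - ξ z - 2 * η * r₀) (fun u hu => (hlow u hu).trans' (by
      have := mul_le_mul_of_nonneg_left (hKr u hu) (show 0 ≤ 2 * η by positivity)
      linarith)) (show 0 < 4 * η by positivity)
      (show u₀ ∈ K from ⟨hu₀C, by rw [mem_closedBall_iff_norm]; linarith⟩)
  simp only [dist_eq_norm] at hx1 hx2
  have hHu₀ : H u₀ < F z - ξ z := by
    rw [map_sub] at hu₀
    simp only [hH]
    linarith
  have hHx : H x < F z - ξ z := by
    have : 0 ≤ 4 * η * ‖x - u₀‖ := by positivity
    linarith
  -- the Ekeland point is localized by comparing the two rates `2 * η` and `4 * η`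
  have hxu₀ : ‖x - u₀‖ ≤ ‖u₀ - z‖ := by
    have h1 := hlow x hxK
    have h2 : ‖x - z‖ ≤ ‖x - u₀‖ + ‖u₀ - z‖ := norm_sub_le_norm_sub_add_norm_sub _ _ _
    have h3 := mul_le_mul_of_nonneg_left h2 (show 0 ≤ 2 * η by positivity)
    have h4 : 2 * η * ‖x - u₀‖ ≤ 2 * η * ‖u₀ - z‖ := by linarith
    exact le_of_mul_le_mul_left h4 (by positivity)
  have hxz : ‖x - z‖ ≤ 2 * ‖u₀ - z‖ := by
    have h2 : ‖x - z‖ ≤ ‖x - u₀‖ + ‖u₀ - z‖ := norm_sub_le_norm_sub_add_norm_sub _ _ _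
    linarith
  have hne : x ≠ z := by
    rintro h
    simp only [hH, h, sub_self, norm_zero, mul_zero, add_zero] at hHx
    exact lt_irrefl _ hHx
  set t := ‖x - z‖
  have ht : 0 < t := norm_pos_iff.2 (sub_ne_zero.2 hne)
  obtain ⟨e, he, hez⟩ := exists_dual_vector ℝ (z - x) (norm_ne_zero_iff.2 (sub_ne_zero.2 hne.symm))
  have hez : e (z - x) = t := by simpa [t, norm_sub_rev] using hez
  have hfar : ∀ u ∈ C, ‖u - x‖ ≤ t →
      a * (t - ‖u - z‖) - 4 * η * ‖u - x‖ ≤ F u - F x - ξ (u - x) := fun u hu hur => by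
    have h2 : ‖u - z‖ ≤ ‖u - x‖ + ‖x - z‖ := norm_sub_le_norm_sub_add_norm_sub _ _ _
    have h1 := hx2 u ⟨hu, by rw [mem_closedBall_iff_norm]; linarith⟩
    simp only [hH] at h1
    rw [map_sub]
    linarith
  set d := t⁻¹ • (z - x)
  have hd : ‖d‖ = 1 := by
    rw [norm_smul, norm_inv, norm_norm, norm_sub_rev z x]
    exact inv_mul_cancel₀ ht.ne'
  have hed : e d = 1 := by
    rw [map_smul, hez, smul_eq_mul]
    exact inv_mul_cancel₀ ht.ne'
  obtain ⟨τ₀, hτ₀, hsm⟩ := exists_norm_sub_le hX' hd he hed (show 0 < η / a by positivity)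
  have hnorm : ‖a • e‖ = a := by rw [norm_smul, he, mul_one, Real.norm_of_nonneg ha0.le]
  refine ⟨⟨x, min (min (τ * t) t) (τ₀ * t), a • e⟩,
    ⟨hρ, by positivity, hxK.1, hne, ?_, ?_, ?_, ?_, ?_,
    fun u hu hur => ?_, fun u hu hur => ?_⟩, ?_⟩
  · change t ≤ _
    linarith
  · exact (min_le_left _ _).trans (min_le_left _ _)
  · rw [hnorm]
    linarith
  · change (a • e) (z - x) = ‖a • e‖ * t
    rw [hnorm, smul_apply, hez, smul_eq_mul]
  · change (‖a • e‖ - τ) * t ≤ F z - F x - ξ (z - x)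
    rw [hnorm, map_sub]
    simp only [hH] at hHx
    have : 0 < τ * t := by positivity
    change F x - ξ x + a * t < _ at hHx
    linarith
  · change ‖a • e‖ * (t - ‖u - z‖) - τ * ‖u - x‖ ≤ _
    rw [hnorm]
    have h1 := hfar u hu hur
    have h2 := mul_le_mul_of_nonneg_right (show 4 * η ≤ τ by linarith) (norm_nonneg (u - x))
    linarith
  · change ‖u - x‖ ≤ min (min (τ * t) t) (τ₀ * t) at hur
    change (a • e) (u - x) - τ * ‖u - x‖ ≤ F u - F x - ξ (u - x)
    have hur1 : ‖u - x‖ ≤ t := hur.trans ((min_le_left _ _).trans (min_le_right _ _))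
    have hur2 : ‖u - x‖ ≤ τ₀ * t := hur.trans (min_le_right _ _)
    have h1 := hfar u hu hur1
    -- linearize `‖u - z‖ = t * ‖d - (u - x) / t‖`
    have h2 := hsm d (t⁻¹ • (u - x)) (by simpa using hτ₀.le) (by
      rw [norm_smul, norm_inv, norm_norm, inv_mul_le_iff₀ ht]
      linarith)
    have h3 : ‖u - z‖ = t * ‖d - t⁻¹ • (u - x)‖ := by
      rw [← smul_sub, norm_smul, norm_inv, norm_norm, mul_inv_cancel_left₀ ht.ne', norm_sub_rev]
      congr 1
      abel
    have h4 : t * ‖d - t⁻¹ • (u - x)‖ ≤ t - e (u - x) + η / a * ‖u - x‖ := by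
      have := mul_le_mul_of_nonneg_left h2 ht.le
      rw [hd, map_smul, smul_eq_mul, norm_smul, norm_inv, norm_norm] at this
      refine this.trans (le_of_eq ?_)
      change t * (1 - t⁻¹ * e (u - x) + η / a * (t⁻¹ * ‖u - x‖)) = _
      field_simp
    have h5 : a * (η / a * ‖u - x‖) = η * ‖u - x‖ := by
      field_simp
    have h6 := mul_le_mul_of_nonneg_left (h3.trans_le h4) ha0.le
    have h7 := mul_le_mul_of_nonneg_right (show 5 * η ≤ τ by linarith) (norm_nonneg (u - x))
    rw [smul_apply, smul_eq_mul]
    linarith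
  · refine lt_of_le_of_lt (b := a + 4 * η) (HasSlopeBound.descentSlope_le
      ⟨by positivity, t, ht, fun u hu hur => ?_⟩) (by linarith)
    have h1 := hfar u hu hur.le
    have h2 : ‖u - z‖ ≤ ‖u - x‖ + ‖x - z‖ := norm_sub_le_norm_sub_add_norm_sub _ _ _
    have h3 := mul_le_mul_of_nonneg_left h2 ha0.le
    have h4 : ξ (x - u) = -ξ (u - x) := by rw [← map_neg, neg_sub]
    change F x - F u - ξ (x - u) ≤ _ * ‖u - x‖
    rw [h4]
    have h5 : a * (‖u - x‖ + ‖x - z‖) = a * ‖u - x‖ + a * t := mul_add _ _ _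
    linarith

end DescentSlope

/-! ### Concatenating finite chains -/

theorem exists_path_of_transGen {S : Type*} {r : S → S → Prop} {a b : S}
    (h : Relation.TransGen r a b) :
    ∃ (n : ℕ) (y : ℕ → S), 0 < n ∧ y 0 = a ∧ y n = b ∧ ∀ i < n, r (y i) (y (i + 1)) := by
  induction h with
  | single h => exact ⟨1, fun i => if i = 0 then a else _, one_pos, rfl, rfl, by simpa using h⟩
  | @tail b c _ hbc ih =>
    obtain ⟨n, y, hn, h0, hb, hy⟩ := ih
    refine ⟨n + 1, fun i => if i ≤ n then y i else c, n.succ_pos, by simpa using h0, by simp, ?_⟩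
    intro i hi
    rcases Nat.lt_succ_iff_lt_or_eq.1 hi with hlt | rfl
    · simpa [hlt.le, Nat.succ_le_of_lt hlt] using hy i hlt
    · simpa [hb] using hbc

/-- Finite chains for decreasing relations `r j` that lead from `σ j` to `σ (j + 1)` concatenate
to an infinite sequence. -/
theorem exists_concatenated_path {S : Type*} {r : ℕ → S → S → Prop}
    (hr : ∀ j a b, r (j + 1) a b → r j a b) {σ : ℕ → S}
    (h : ∀ j, Relation.TransGen (r j) (σ j) (σ (j + 1))) :
    ∃ (x : ℕ → S) (φ : ℕ → ℕ), StrictMono φ ∧ φ 0 = 0 ∧ (∀ j, x (φ j) = σ j) ∧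
      ∀ j i, φ j ≤ i → r j (x i) (x (i + 1)) := by
  choose n y hn hy0 hyn hy using fun j => exists_path_of_transGen (h j)
  let φ : ℕ → ℕ := fun j => ∑ k ∈ Finset.range j, n k
  have hφs : ∀ j, φ (j + 1) = φ j + n j := fun j => Finset.sum_range_succ _ _
  have hφ : StrictMono φ := strictMono_nat_of_lt_succ fun j => by
    have := hn j
    rw [hφs]; omega
  have hφ0 : φ 0 = 0 := by simp [φ]
  have hblock : ∀ i, ∃ j, φ j ≤ i ∧ i < φ (j + 1) := by
    intro i
    have hex : ∃ j, i < φ (j + 1) := ⟨i, (Nat.lt_succ_self i).trans_le (hφ.id_le (i + 1))⟩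
    classical
    refine ⟨Nat.find hex, ?_, Nat.find_spec hex⟩
    rcases Nat.eq_zero_or_pos (Nat.find hex) with h0 | hpos
    · rw [h0, hφ0]; exact Nat.zero_le _
    · have h1 := Nat.find_min hex (Nat.sub_lt hpos one_pos)
      rw [show Nat.find hex - 1 + 1 = Nat.find hex by omega] at h1
      exact not_lt.1 h1
  choose J hJ1 hJ2 using hblock
  have hJu : ∀ i j, φ j ≤ i → i < φ (j + 1) → J i = j := by
    intro i j h1 h2
    have h3 := hφ.lt_iff_lt.1 ((hJ1 i).trans_lt h2)
    have h4 := hφ.lt_iff_lt.1 (h1.trans_lt (hJ2 i))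
    omega
  have hx : ∀ i j, φ j ≤ i → i ≤ φ (j + 1) → y (J i) (i - φ (J i)) = y j (i - φ j) := by
    intro i j h1 h2
    rcases h2.lt_or_eq with hlt | rfl
    · rw [hJu i j h1 hlt]
    · rw [hJu _ (j + 1) le_rfl (hφ (Nat.lt_succ_self _)), Nat.sub_self, hy0, hφs,
        Nat.add_sub_cancel_left, hyn]
  have hanti : ∀ j k a b, j ≤ k → r k a b → r j a b := by
    intro j k a b hjk
    induction hjk with
    | refl => exact id
    | step _ ih => exact fun h => ih (hr _ _ _ h)
  refine ⟨fun i => y (J i) (i - φ (J i)), φ, hφ, hφ0, fun j => ?_, fun j i hji => ?_⟩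
  · simp only
    rw [hx _ j le_rfl (hφ (Nat.lt_succ_self _)).le, Nat.sub_self, hy0]
  · have hlt := hJ2 i
    have hle := hJ1 i
    have hjJ : j ≤ J i := Nat.lt_succ_iff.1 (hφ.lt_iff_lt.1 (hji.trans_lt hlt))
    refine hanti j (J i) _ _ hjJ ?_
    simp only
    rw [hx (i + 1) (J i) (by omega) (by omega), Nat.sub_add_comm hle]
    refine hy (J i) _ ?_
    rw [hφs] at hlt
    omega

section Descent

variable {X : Type*} [NormedAddCommGroup X] [NormedSpace ℝ X]
variable {F : X → ℝ} {C : Set X} {ξ : StrongDual ℝ X} {ℓ τ c : ℝ} {σ σ' : ProxState X}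

open Relation

/-! ### Stages of the descent -/

theorem ProxStep.norm_add_radius_le (hs : ProxStep F C ξ τ c σ σ') (hτ : τ ≤ 1 / 2) :
    ‖σ'.pt - σ.pt‖ + σ'.radius ≤ σ.radius := by
  have h1 := hs.dist_le
  have h2 := hs.radius_le
  have h3 := mul_le_mul_of_nonneg_right hτ hs.radius_pos.le
  have h4 := mul_le_mul_of_nonneg_right hτ (norm_nonneg (σ'.pt - σ.pt))
  have h5 := hs.radius_pos
  linarith

theorem norm_add_radius_le_of_reflTransGen (hτ : τ ≤ 1 / 2)
    (h : ReflTransGen (ProxStep F C ξ τ c) σ σ') : ‖σ'.pt - σ.pt‖ + σ'.radius ≤ σ.radius := by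
  induction h with
  | refl => simp
  | @tail b d _ hbd ih =>
    have h1 := hbd.norm_add_radius_le hτ
    have h2 : ‖d.pt - σ.pt‖ ≤ ‖d.pt - b.pt‖ + ‖b.pt - σ.pt‖ :=
      norm_sub_le_norm_sub_add_norm_sub _ _ _
    linarith

theorem mem_and_radius_pos_of_reflTransGen (h : ReflTransGen (ProxStep F C ξ τ c) σ σ')
    (hσ : σ.pt ∈ C) (hρ : 0 < σ.radius) : σ'.pt ∈ C ∧ 0 < σ'.radius := by
  cases h with
  | refl => exact ⟨hσ, hρ⟩
  | tail _ hbd => exact ⟨hbd.mem, hbd.radius_pos'⟩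

/-- The parameters of the descent between two perturbations: current state, perturbation, bound
for the norms of the functionals, and tolerance. -/
structure Stage (X : Type*) [NormedAddCommGroup X] [NormedSpace ℝ X] where
  /-- the current state -/
  state : ProxState X
  /-- the linear functional subtracted from the objective -/
  pert : StrongDual ℝ X
  /-- an upper bound for the norms of the functionals in later steps -/
  bound : ℝ
  /-- the tolerance of later steps -/
  tol : ℝ

/-- The steps allowed at a stage. -/
abbrev Stage.Step (F : X → ℝ) (C : Set X) (S : Stage X) : ProxState X → ProxState X → Prop :=
  ProxStep F C S.pert S.tol S.bound

/-- The stage lies in the ball of radius `ρ₀` about `x₀`, its perturbation is small compared with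
`ε`, and its bound exceeds the current slope. -/
structure Stage.Valid (F : X → ℝ) (C : Set X) (x₀ : X) (ρ₀ ε : ℝ) (S : Stage X) : Prop where
  mem : S.state.pt ∈ C
  radius_pos : 0 < S.state.radius
  dist_le : ‖S.state.pt - x₀‖ + S.state.radius ≤ ρ₀
  slope_lt : descentSlope F C S.pert S.state.pt < S.bound
  tol_pos : 0 < S.tol
  tol_le : S.tol ≤ 1 / 2
  pert_le : ‖S.pert‖ + S.tol ≤ ε / 4

variable {x₀ : X} {ρ₀ ε : ℝ} {S : Stage X}

theorem Stage.Valid.dist_le_of_reflTransGen (hS : S.Valid F C x₀ ρ₀ ε)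
    (h : ReflTransGen (S.Step F C) S.state σ) : ‖σ.pt - x₀‖ + σ.radius ≤ ρ₀ := by
  have h1 := norm_add_radius_le_of_reflTransGen hS.tol_le h
  have h2 := hS.dist_le
  have h3 : ‖σ.pt - x₀‖ ≤ ‖σ.pt - S.state.pt‖ + ‖S.state.pt - x₀‖ :=
    norm_sub_le_norm_sub_add_norm_sub _ _ _
  linarith

/-- A uniform lower bound for the slopes near `x₀` bounds the functionals of all steps from
below. -/
theorem Stage.Valid.le_norm_grad (hS : S.Valid F C x₀ ρ₀ ε) (hF : LipschitzBoundOn ℓ F C)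
    (hslope : ∀ z ∈ C, ‖z - x₀‖ ≤ ρ₀ → ε ≤ descentSlope F C 0 z)
    (h : ReflTransGen (S.Step F C) S.state σ) (hs : S.Step F C σ σ') :
    3 / 4 * ε ≤ ‖σ'.grad‖ := by
  have h1 := hS.dist_le_of_reflTransGen (h.tail hs)
  have h2 := hslope _ hs.mem (by linarith [hs.radius_pos'])
  have h3 := hF.descentSlope_le_add hs.mem 0 S.pert
  have h4 := ProxStep.descentSlope_le hs 0
  rw [add_zero, sub_zero] at h4
  rw [zero_sub, norm_neg] at h3
  have h5 := hS.pert_le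
  linarith

theorem norm_le_of_neg_mul_norm_le_apply {w : X} {K ϱ : ℝ} (hϱ : 0 < ϱ) (hK : 0 ≤ K)
    (h : ∀ g : StrongDual ℝ X, ‖g‖ ≤ ϱ → -(K * ‖g‖) ≤ g w) : ‖w‖ ≤ K := by
  rcases eq_or_ne w 0 with rfl | hw
  · simpa using hK
  obtain ⟨g, hg, hgw⟩ := exists_dual_vector ℝ w (norm_ne_zero_iff.2 hw)
  have hgw : g w = ‖w‖ := by simpa using hgw
  have hn : ‖(-ϱ) • g‖ = ϱ := by rw [norm_smul, hg, mul_one, norm_neg, Real.norm_of_nonneg hϱ.le]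
  have h1 := h ((-ϱ) • g) hn.le
  rw [hn, smul_apply, hgw, smul_eq_mul] at h1
  nlinarith

/-- **Perturbation step.** Let `N η` be the infimum of the slopes of `F - η` over all reachable
states. A perturbed minimum of `N + M‖· - ξ‖²` on the dual is a point `ξ'` where `N` has an
approximate lower derivative `-w`. A functional `p` of a later step whose norm is close to `N ξ'`
satisfies `N (ξ' + t p / ‖p‖) ≤ ‖p‖ - t + …`, which forces `p w` to be close to `‖p‖`. The order of
the choices matters: `w` and the radius in which it is a derivative are fixed before the state is
moved to a nearly minimal slope. -/
theorem Stage.Valid.exists_next [CompleteSpace X] (hrefl : Reflexive X)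
    (hX : LocallyUniformlyConvex X) (hX' : LocallyUniformlyConvex (StrongDual ℝ X))
    (hC : IsClosed C) (hF : LipschitzBoundOn ℓ F C) (hε : 0 < ε)
    (hslope : ∀ z ∈ C, ‖z - x₀‖ ≤ ρ₀ → ε ≤ descentSlope F C 0 z)
    (hS : S.Valid F C x₀ ρ₀ ε) {δ : ℝ} (hδ : 0 < δ) :
    ∃ (S' : Stage X) (w : X), S'.Valid F C x₀ ρ₀ ε ∧ TransGen (S.Step F C) S.state S'.state ∧
      ‖S'.pert - S.pert‖ + S'.tol ≤ S.tol ∧ S'.bound ≤ S.bound ∧ S'.tol ≤ δ ∧ ‖w‖ ≤ 1 + δ ∧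
      ∀ σ σ', ReflTransGen (S'.Step F C) S'.state σ → S'.Step F C σ σ' →
        (1 - δ) * ‖σ'.grad‖ ≤ σ'.grad w ∧ S'.bound - δ ≤ ‖σ'.grad‖ := by
  set R : Set (ProxState X) := {σ | ReflTransGen (S.Step F C) S.state σ}
  have hRC : ∀ σ ∈ R, σ.pt ∈ C ∧ 0 < σ.radius := fun σ hσ =>
    mem_and_radius_pos_of_reflTransGen hσ hS.mem hS.radius_pos
  let N : StrongDual ℝ X → ℝ := fun η => ⨅ σ : R, descentSlope F C η σ.1.pt
  have hne : Nonempty R := ⟨⟨S.state, ReflTransGen.refl⟩⟩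
  have hNbdd : ∀ η, BddBelow (Set.range fun σ : R => descentSlope F C η σ.1.pt) := fun η =>
    ⟨0, by rintro _ ⟨σ, rfl⟩; exact descentSlope_nonneg⟩
  have hNle : ∀ η, ∀ σ ∈ R, N η ≤ descentSlope F C η σ.pt := fun η σ hσ =>
    ciInf_le (hNbdd η) (⟨σ, hσ⟩ : R)
  have hN0 : ∀ η, 0 ≤ N η := fun η => le_ciInf fun σ => descentSlope_nonneg
  have hNlip : ∀ η η', N η ≤ N η' + ‖η - η'‖ := fun η η' => by
    rw [← sub_le_iff_le_add]
    refine le_ciInf fun σ => ?_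
    have h1 := hNle η σ.1 σ.2
    have h2 := hF.descentSlope_le_add (hRC σ.1 σ.2).1 η η'
    linarith
  set m := S.bound - descentSlope F C S.pert S.state.pt with hm
  have hm0 : 0 < m := sub_pos.2 hS.slope_lt
  have hτ0 := hS.tol_pos
  -- Since `N` is 1-Lipschitz, the penalty `κ⁻¹‖· - S.pert‖²` keeps `ξ'` within `κ` of `S.pert`.
  set κ := min (S.tol / 4) (m / 4)
  have hκ0 : 0 < κ := by positivity
  have hκ1 : κ ≤ S.tol / 4 := min_le_left _ _
  have hκ2 : κ ≤ m / 4 := min_le_right _ _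
  have hHcont : ContinuousOn (fun η => N η + κ⁻¹ * ‖η - S.pert‖ ^ 2) Set.univ := by
    have h1 : Continuous N := (LipschitzWith.of_le_add (f := N) fun η η' => by
      rw [dist_eq_norm]; exact hNlip η η').continuous
    exact (h1.add (by fun_prop)).continuousOn
  obtain ⟨ξ', -, hξ1, hξ2⟩ := exists_ekeland_point isClosed_univ hHcont (m := 0)
    (fun η _ => add_nonneg (hN0 η) (by positivity)) (show 0 < δ / 4 by positivity)
    (Set.mem_univ S.pert)
  simp only [sub_self, norm_zero, dist_eq_norm] at hξ1 hξ2
  set ζ := ξ' - S.pert with hζ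
  have hζκ : ‖ζ‖ ≤ κ := by
    have h1 := hNlip S.pert ξ'
    rw [norm_sub_rev] at h1
    have h2 : 0 ≤ δ / 4 * ‖ζ‖ := by positivity
    have h3 : κ⁻¹ * ‖ζ‖ ^ 2 ≤ ‖ζ‖ := by
      simp only [ne_eq, OfNat.ofNat_ne_zero, not_false_eq_true, zero_pow, mul_zero, add_zero] at hξ1
      linarith
    rw [inv_mul_le_iff₀ hκ0, sq] at h3
    rcases (norm_nonneg ζ).eq_or_lt with h0 | h0
    · rw [← h0]; exact hκ0.le
    · exact le_of_mul_le_mul_right h3 h0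
  obtain ⟨w, ϱ, hϱ, hw⟩ := exists_dual_norm_sq_add_le hrefl hX ζ (inv_pos.2 hκ0)
    (show 0 < δ / 4 by positivity)
  have hE : ∀ h : StrongDual ℝ X, ‖h‖ ≤ ϱ → N ξ' ≤ N (ξ' + h) + h w + δ / 2 * ‖h‖ := by
    intro h hh
    have h1 := hξ2 (ξ' + h) (Set.mem_univ _)
    have h2 := hw h hh
    rw [add_sub_cancel_left, add_sub_right_comm, ← hζ] at h1
    linarith
  have hwn : ‖w‖ ≤ 1 + δ := by
    refine norm_le_of_neg_mul_norm_le_apply hϱ (by positivity) fun g hg => ?_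
    have h1 := hE g hg
    have h2 := hNlip (ξ' + g) ξ'
    rw [add_sub_cancel_left] at h2
    have h3 : 0 ≤ δ / 2 * ‖g‖ := by positivity
    linarith
  set ϱ₁ := min ϱ (ε / 4)
  have hϱ₁ : 0 < ϱ₁ := by positivity
  obtain ⟨t, ht, ht1, ht2, ht3, ht4⟩ : ∃ t : ℝ, 0 < t ∧ t ≤ S.tol / 4 ∧ t ≤ m / 4 ∧ t ≤ δ / 2 ∧
      t ≤ δ / 4 * ϱ₁ :=
    ⟨min (min (S.tol / 4) (m / 4)) (min (δ / 2) (δ / 4 * ϱ₁)), by positivity,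
      (min_le_left _ _).trans (min_le_left _ _), (min_le_left _ _).trans (min_le_right _ _),
      (min_le_right _ _).trans (min_le_left _ _), (min_le_right _ _).trans (min_le_right _ _)⟩
  have hNc : N ξ' + t ≤ S.bound := by
    have h1 := hNlip ξ' S.pert
    have h2 := hNle S.pert S.state ReflTransGen.refl
    linarith
  have hpert : ‖ξ' - S.pert‖ + t ≤ S.tol := by linarith
  have hξ'n : ‖ξ'‖ + t ≤ ε / 4 := by
    have h1 := hS.pert_le
    have h2 : ‖ξ'‖ ≤ ‖ξ' - S.pert‖ + ‖S.pert‖ := by simpa using norm_add_le (ξ' - S.pert) S.pert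
    linarith
  obtain ⟨⟨σ₁, hσ₁⟩, hσ₁s⟩ := exists_lt_of_ciInf_lt (show N ξ' < N ξ' + t by linarith)
  obtain ⟨hσ₁C, hσ₁r⟩ := hRC σ₁ hσ₁
  have hσ₁d := hS.dist_le_of_reflTransGen hσ₁
  have hσ₁pos : 0 < descentSlope F C ξ' σ₁.pt := by
    have h1 := hslope _ hσ₁C (by linarith)
    have h2 := hF.descentSlope_le_add hσ₁C 0 ξ'
    rw [zero_sub, norm_neg] at h2
    linarith
  obtain ⟨σ₂, hstep, hσ₂s⟩ := exists_proxStep hX' hC hF hσ₁C hσ₁r hσ₁pos hσ₁s ht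
  have hmono : ∀ a b, ProxStep F C ξ' t (N ξ' + t) a b → S.Step F C a b := fun a b hab =>
    hab.mono hpert hNc
  have htrans : TransGen (S.Step F C) S.state σ₂ := TransGen.tail' hσ₁ (hmono _ _ hstep)
  have hvalid : (Stage.mk σ₂ ξ' (N ξ' + t) t).Valid F C x₀ ρ₀ ε :=
    ⟨hstep.mem, hstep.radius_pos', hS.dist_le_of_reflTransGen htrans.to_reflTransGen, hσ₂s, ht, by
      have := hS.tol_le
      simp only
      linarith, hξ'n⟩
  refine ⟨⟨σ₂, ξ', N ξ' + t, t⟩, w, hvalid, htrans, hpert, hNc, by simp only; linarith, hwn,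
    fun a b ha hab => ?_⟩
  have hbR : b ∈ R := htrans.to_reflTransGen.trans
    ((ReflTransGen.mono hmono _ _ ha).tail (hmono _ _ hab))
  have hp := hvalid.le_norm_grad hF hslope ha hab
  have hp0 : 0 < ‖b.grad‖ := by linarith
  have hpc : ‖b.grad‖ ≤ N ξ' + t := hab.norm_le
  constructor
  · -- Adding `h`, the multiple of `b.grad` of norm `ϱ₁`, lowers the slope bound at `b` by `ϱ₁`.
    have hh : ‖(ϱ₁ / ‖b.grad‖) • b.grad‖ = ϱ₁ := by
      rw [norm_smul, Real.norm_of_nonneg (by positivity), div_mul_cancel₀ _ hp0.ne']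
    have h1 := hE ((ϱ₁ / ‖b.grad‖) • b.grad) (hh.trans_le (min_le_left _ _))
    have h2 := hNle (ξ' + (ϱ₁ / ‖b.grad‖) • b.grad) b hbR
    have h3 := ProxStep.descentSlope_le hab ((ϱ₁ / ‖b.grad‖) • b.grad)
    have h4 : ‖b.grad - (ϱ₁ / ‖b.grad‖) • b.grad‖ = ‖b.grad‖ - ϱ₁ := by
      have h5 : b.grad - (ϱ₁ / ‖b.grad‖) • b.grad = (1 - ϱ₁ / ‖b.grad‖) • b.grad := by
        module
      have h6 : ϱ₁ ≤ ‖b.grad‖ := (min_le_right _ _).trans (by linarith)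
      have h7 : ϱ₁ / ‖b.grad‖ ≤ 1 := (div_le_one hp0).2 h6
      rw [h5, norm_smul, Real.norm_of_nonneg (by linarith), sub_mul, div_mul_cancel₀ _ hp0.ne',
        one_mul]
    rw [hh, smul_apply, smul_eq_mul] at h1
    rw [h4] at h3
    have h8 : ϱ₁ * (1 - δ) ≤ ϱ₁ * (b.grad w / ‖b.grad‖) := by
      have h9 : ϱ₁ * (b.grad w / ‖b.grad‖) = ϱ₁ / ‖b.grad‖ * b.grad w := by ring
      simp only at h3
      linarith
    have h9 := le_of_mul_le_mul_left h8 hϱ₁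
    rwa [le_div_iff₀ hp0] at h9
  · have h1 := hNle ξ' b hbR
    have h2 := ProxStep.descentSlope_le hab 0
    rw [add_zero, sub_zero] at h2
    simp only at h2 ⊢
    linarith

end Descent

section Sequence

variable {X : Type*} [NormedAddCommGroup X] [NormedSpace ℝ X]
variable {F : X → ℝ} {C : Set X} {ℓ ρ₀ ε : ℝ} {x₀ : X}

open Relation

/-! ### The descent sequence -/

/-- Iterating the perturbation step gives an infinite descent for one perturbed objective `F - η`,
with tolerances tending to zero and norm convergent functionals. -/
theorem exists_descent_sequence [CompleteSpace X] (hrefl : Reflexive X)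
    (hX : LocallyUniformlyConvex X) (hX' : LocallyUniformlyConvex (StrongDual ℝ X))
    (hC : IsClosed C) (hF : LipschitzBoundOn ℓ F C) (hε : 0 < ε)
    (hslope : ∀ z ∈ C, ‖z - x₀‖ ≤ ρ₀ → ε ≤ descentSlope F C 0 z) (hx₀ : x₀ ∈ C) (hρ₀ : 0 < ρ₀) :
    ∃ (x : ℕ → ProxState X) (η p : StrongDual ℝ X) (c : ℝ), ‖η‖ ≤ ε / 4 ∧ (x 0).pt = x₀ ∧
      (x 0).radius = ρ₀ ∧ (∀ i, ProxStep F C η (1 / 2) c (x i) (x (i + 1))) ∧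
      (∀ τ : ℝ, 0 < τ → ∀ᶠ i in atTop, ProxStep F C η τ c (x i) (x (i + 1))) ∧
      Tendsto (fun i => (x i).grad) atTop (𝓝 p) ∧ p ≠ 0 := by
  let V := {S : Stage X // S.Valid F C x₀ ρ₀ ε}
  let S₀ : V := ⟨⟨⟨x₀, ρ₀, 0⟩, 0, descentSlope F C 0 x₀ + 1, min (1 / 4) (ε / 4)⟩,
    ⟨hx₀, hρ₀, by simp, lt_add_one _, by simp only; positivity,
      (min_le_left _ _).trans (by norm_num), by simp⟩⟩
  have hnext := fun (S : V) (j : ℕ) => S.2.exists_next hrefl hX hX' hC hF hε hslope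
    (Nat.one_div_pos_of_nat (α := ℝ) (n := j))
  choose next w hval htrans hpert hbound htol hw hgrad using hnext
  let S : ℕ → V := fun j => Nat.rec S₀ (fun j S => ⟨next S j, hval S j⟩) j
  obtain ⟨x, φ, hφ, hφ0, hxφ, hx⟩ := exists_concatenated_path
    (r := fun j => (S j).1.Step F C) (σ := fun j => (S j).1.state)
    (fun j a b hab => ProxStep.mono hab (hpert (S j) j) (hbound (S j) j))
    (fun j => htrans (S j) j)
  have hreach : ∀ j i, φ j ≤ i → ReflTransGen ((S j).1.Step F C) (S j).1.state (x i) := by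
    intro j i hi
    induction i, hi using Nat.le_induction with
    | base => rw [hxφ]
    | succ i hi ih => exact ih.tail (hx j i hi)
  -- the perturbations converge
  have htol0 : Tendsto (fun j => (S j).1.tol) atTop (𝓝 0) := by
    refine (tendsto_add_atTop_iff_nat 1).1 (squeeze_zero (fun j => (S (j + 1)).2.tol_pos.le)
      (fun j => htol (S j) j) tendsto_one_div_add_atTop_nhds_zero_nat)
  have hpertle : ∀ j k, j ≤ k → ‖(S k).1.pert - (S j).1.pert‖ + (S k).1.tol ≤ (S j).1.tol := by
    intro j k hjk
    induction k, hjk using Nat.le_induction with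
    | base => simp
    | succ k hk ih =>
      have h1 : ‖(S (k + 1)).1.pert - (S k).1.pert‖ + (S (k + 1)).1.tol ≤ (S k).1.tol :=
        hpert (S k) k
      have h2 := norm_sub_le_norm_sub_add_norm_sub (S (k + 1)).1.pert (S k).1.pert (S j).1.pert
      linarith
  have hpertle' : ∀ j k, j ≤ k → ‖(S k).1.pert - (S j).1.pert‖ ≤ (S j).1.tol := fun j k hjk => by
    have h1 := hpertle j k hjk
    have h2 := (S k).2.tol_pos
    linarith
  have hcau : CauchySeq fun j => (S j).1.pert := by
    refine cauchySeq_of_le_tendsto_0 (fun j => (S j).1.tol + (S j).1.tol) (fun n m N hn hm => ?_)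
      (by simpa using htol0.add htol0)
    rw [dist_eq_norm]
    have h1 := hpertle' N n hn
    have h2 := hpertle' N m hm
    rw [norm_sub_rev] at h2
    have h3 := norm_sub_le_norm_sub_add_norm_sub (S n).1.pert (S N).1.pert (S m).1.pert
    linarith
  obtain ⟨η, hη⟩ := cauchySeq_tendsto_of_complete hcau
  have hηle : ∀ j, ‖(S j).1.pert - η‖ ≤ (S j).1.tol := fun j => by
    rw [norm_sub_rev]
    exact le_of_tendsto (hη.sub_const _).norm
      ((eventually_ge_atTop j).mono fun k hk => hpertle' j k hk)
  have hcanti : Antitone fun j => (S j).1.bound := antitone_nat_of_succ_le fun j => hbound (S j) j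
  have hstep : ∀ j i, φ j ≤ i →
      ProxStep F C η (2 * (S j).1.tol) (S 0).1.bound (x i) (x (i + 1)) := fun j i hi =>
    ProxStep.mono (hx j i hi) (by linarith [hηle j]) (hcanti (Nat.zero_le j))
  have hS0tol : 2 * (S 0).1.tol ≤ 1 / 2 := by
    have : (S 0).1.tol ≤ 1 / 4 := min_le_left _ _
    linarith
  -- the functionals have norms converging to a positive number
  set g : ℕ → StrongDual ℝ X := fun i => (x (i + 1)).grad with hg
  have hgε : ∀ i, 3 / 4 * ε ≤ ‖g i‖ := fun i => (S 0).2.le_norm_grad hF hslope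
    (hreach 0 i (by rw [hφ0]; exact Nat.zero_le i)) (hx 0 i (by rw [hφ0]; exact Nat.zero_le i))
  have hgpos : ∀ i, 0 < ‖g i‖ := fun i => lt_of_lt_of_le (by positivity) (hgε i)
  have hgw : ∀ j i, φ (j + 1) ≤ i → (1 - 1 / ((j : ℝ) + 1)) * ‖g i‖ ≤ g i (w (S j) j) ∧
      (S (j + 1)).1.bound - 1 / ((j : ℝ) + 1) ≤ ‖g i‖ := fun j i hi =>
    hgrad (S j) j (x i) (x (i + 1)) (hreach (j + 1) i hi) (hx (j + 1) i hi)
  have hcbdd : BddBelow (Set.range fun j => (S j).1.bound) :=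
    ⟨0, by rintro _ ⟨j, rfl⟩; exact descentSlope_nonneg.trans (S j).2.slope_lt.le⟩
  have hclim := tendsto_atTop_ciInf hcanti hcbdd
  set b := ⨅ j, (S j).1.bound
  have hδ0 : Tendsto (fun j : ℕ => 1 / ((j : ℝ) + 1)) atTop (𝓝 0) :=
    tendsto_one_div_add_atTop_nhds_zero_nat
  have hgnorm : Tendsto (fun i => ‖g i‖) atTop (𝓝 b) := by
    refine Metric.tendsto_nhds.2 fun γ hγ => ?_
    obtain ⟨j, hj1, hj2⟩ := ((((tendsto_add_atTop_iff_nat 1).2 hclim).eventually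
      (gt_mem_nhds (lt_add_of_pos_right b hγ))).and (hδ0.eventually (gt_mem_nhds hγ))).exists
    filter_upwards [eventually_ge_atTop (φ (j + 1))] with i hi
    have h1 := (hgw j i hi).2
    have h2 : b ≤ (S (j + 1)).1.bound := ciInf_le hcbdd (j + 1)
    have h3 : ‖g i‖ ≤ (S (j + 1)).1.bound := (hx (j + 1) i hi).norm_le
    rw [Real.dist_eq, abs_lt]
    constructor <;> linarith
  have hb : 0 < b := lt_of_lt_of_le (by positivity) (ge_of_tendsto' hgnorm hgε)
  obtain ⟨e, he, hlim⟩ := exists_tendsto_of_uniform_pairing hX' (e := fun i => ‖g i‖⁻¹ • g i)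
    (fun i => by rw [norm_smul, norm_inv, norm_norm, inv_mul_cancel₀ (hgpos i).ne'])
    (fun δ hδ => by
      obtain ⟨j, hj⟩ := (hδ0.eventually (gt_mem_nhds hδ)).exists
      refine ⟨w (S j) j, (hw (S j) j).trans (by linarith), ?_⟩
      filter_upwards [eventually_ge_atTop (φ (j + 1))] with i hi
      rw [smul_apply, smul_eq_mul, ← div_eq_inv_mul, le_div_iff₀ (hgpos i)]
      refine le_trans ?_ (hgw j i hi).1
      exact mul_le_mul_of_nonneg_right (by linarith) (hgpos i).le)
  have hglim : Tendsto g atTop (𝓝 (b • e)) := by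
    refine (hgnorm.smul hlim).congr fun i => ?_
    rw [smul_smul, mul_inv_cancel₀ (hgpos i).ne', one_smul]
  refine ⟨x, η, b • e, (S 0).1.bound, ?_, ?_, ?_, fun i => ?_, fun τ hτ => ?_,
    (tendsto_add_atTop_iff_nat 1).1 hglim, ?_⟩
  · have h1 := hηle 0
    have h2 : (S 0).1.tol ≤ ε / 4 := min_le_right _ _
    have h3 : (S 0).1.pert = 0 := rfl
    rw [h3, zero_sub, norm_neg] at h1
    linarith
  · have := hxφ 0
    rw [hφ0] at this
    rw [this]
    rfl
  · have := hxφ 0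
    rw [hφ0] at this
    rw [this]
    rfl
  · exact (hstep 0 i (by rw [hφ0]; exact Nat.zero_le i)).mono (by simpa using hS0tol) le_rfl
  · obtain ⟨j, hj⟩ := (htol0.eventually (gt_mem_nhds (show 0 < τ / 2 by positivity))).exists
    filter_upwards [eventually_ge_atTop (φ j)] with i hi
    exact (hstep j i hi).mono (by simp only [sub_self, norm_zero, zero_add]; linarith) le_rfl
  · rw [← norm_pos_iff, norm_smul, he, mul_one, Real.norm_of_nonneg hb.le]
    exact hb

end Sequence

section Limit

variable {X : Type*} [NormedAddCommGroup X] [NormedSpace ℝ X]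
variable {F : X → ℝ} {C : Set X} {ℓ c κ : ℝ} {η p : StrongDual ℝ X}

/-! ### The limit of the descent -/

/-- The subgradient inequality at the limit point `z`, for points `u` whose distance from `z` lies
between the scales of two consecutive steps. Seen from `σ₁.pt`, the inequalities `near` and `far`
of the first step apply to `u`, and the drop in the second step compares `σ₁.pt` with `z`. -/
theorem subgradient_between_scales (hF : LipschitzBoundOn ℓ F C) {σ₀ σ₁ σ₂ : ProxState X}
    (h₁ : ProxStep F C η κ c σ₀ σ₁) (h₂ : ProxStep F C η κ c σ₁ σ₂) {z u : X} (hzC : z ∈ C)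
    (huC : u ∈ C) (hz₁ : ‖z - σ₁.pt‖ ≤ σ₁.radius) (hz₂ : ‖z - σ₂.pt‖ ≤ σ₂.radius)
    (hp₁ : ‖σ₁.grad - p‖ ≤ κ) (hp₂ : ‖σ₂.grad - p‖ ≤ κ) {e : StrongDual ℝ X} (he : ‖e‖ = 1)
    (hpe : p = ‖p‖ • e) {τ ε γ : ℝ} (hτ : 0 < τ) (hτ1 : τ ≤ 1) (hε : 0 ≤ ε)
    (hsm : ∀ h : X, ‖h‖ ≤ τ →
      ‖‖σ₁.pt - σ₀.pt‖⁻¹ • (σ₀.pt - σ₁.pt) - h‖ ≤ 1 - e h + ε * ‖h‖)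
    (hlo : τ / 2 * ‖σ₂.pt - σ₁.pt‖ < ‖u - z‖) (hhi : ‖u - z‖ ≤ τ / 2 * ‖σ₁.pt - σ₀.pt‖)
    (hκ1 : κ ≤ 1 / 4) (hκτ : κ ≤ τ / 2) (hκ2 : 2 * κ * (1 + 4 / τ) ≤ γ / 4)
    (hεγ : (‖p‖ + 1) * ε ≤ γ / 8) (hκ3 : 4 * κ ≤ γ / 4)
    (hκ4 : κ * (2 + (|ℓ| + ‖η‖) + ‖p‖) * (2 / τ) ≤ γ / 4) :
    p (u - z) - γ * ‖u - z‖ ≤ F u - F z - η (u - z) := by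
  set r₁ := ‖σ₁.pt - σ₀.pt‖
  set r₂ := ‖σ₂.pt - σ₁.pt‖
  set y := σ₁.pt
  set R := ‖u - z‖
  have hκ0 := h₁.tol_pos
  have hr₁ : 0 < r₁ := h₁.norm_sub_pos
  have hr₂ : 0 < r₂ := h₂.norm_sub_pos
  have hr₂R : r₂ ≤ 2 / τ * R := by
    rw [div_mul_eq_mul_div, le_div_iff₀ hτ]
    linarith
  have hR0 : 0 ≤ R := norm_nonneg _
  have hzy : ‖z - y‖ ≤ 2 * r₂ := by
    have h3 : ‖z - y‖ ≤ ‖z - σ₂.pt‖ + ‖σ₂.pt - y‖ := norm_sub_le_norm_sub_add_norm_sub _ _ _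
    have h4 := h₂.radius_le
    have h5 := mul_le_mul_of_nonneg_right (hκ1.trans (by norm_num : (1 / 4 : ℝ) ≤ 1)) hr₂.le
    change ‖z - y‖ ≤ ‖z - σ₂.pt‖ + r₂ at h3
    linarith
  have huy : ‖u - y‖ ≤ R + ‖z - y‖ := norm_sub_le_norm_sub_add_norm_sub _ _ _
  have huyτ : ‖u - y‖ ≤ τ * r₁ := by
    have h3 := h₁.radius_le
    have h4 := mul_le_mul_of_nonneg_right hκτ hr₁.le
    linarith
  -- comparison of `u` with `y`
  have hfirst : p (u - y) - γ / 2 * R ≤ F u - F y - η (u - y) := by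
    rcases le_or_gt ‖u - y‖ σ₁.radius with hle | hgt
    · have h3 := h₁.near u huC hle
      have h4 := neg_le_apply (σ₁.grad - p) (u - y)
      have h5 := mul_le_mul_of_nonneg_right hp₁ (norm_nonneg (u - y))
      rw [sub_apply] at h4
      have h6 : ‖u - y‖ ≤ (1 + 4 / τ) * R := by
        have h7 : 4 / τ * R = 2 * (2 / τ * R) := by ring
        linarith
      have h7 := mul_le_mul_of_nonneg_left h6 (show 0 ≤ 2 * κ by positivity)
      have h8 := mul_le_mul_of_nonneg_right hκ2 hR0
      have h9 : 0 ≤ γ := by linarith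
      have h10 : 0 ≤ γ * R := mul_nonneg h9 hR0
      linarith
    · have h3 := h₁.far u huC (huyτ.trans (by
        have := mul_le_mul_of_nonneg_right hτ1 hr₁.le
        change τ * r₁ ≤ r₁
        linarith))
      change ‖σ₁.grad‖ * (r₁ - ‖u - σ₀.pt‖) - κ * ‖u - y‖ ≤ F u - F y - η (u - y) at h3
      have h4 := hsm (r₁⁻¹ • (u - y)) (by
        rw [norm_smul, norm_inv, norm_norm, inv_mul_le_iff₀ hr₁]
        change ‖u - y‖ ≤ r₁ * τ
        linarith)
      have h5 : r₁ * ‖r₁⁻¹ • (σ₀.pt - y) - r₁⁻¹ • (u - y)‖ = ‖u - σ₀.pt‖ := by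
        rw [← smul_sub, norm_smul, norm_inv, norm_norm]
        change r₁ * (r₁⁻¹ * _) = _
        rw [mul_inv_cancel_left₀ hr₁.ne', norm_sub_rev]
        congr 1
        abel
      have h6 : e (u - y) - ε * ‖u - y‖ ≤ r₁ - ‖u - σ₀.pt‖ := by
        have h7 := mul_le_mul_of_nonneg_left h4 hr₁.le
        rw [h5, map_smul, smul_eq_mul, norm_smul, norm_inv, norm_norm] at h7
        have h8 : r₁ * (1 - r₁⁻¹ * e (u - y) + ε * (r₁⁻¹ * ‖u - y‖)) =
            r₁ - e (u - y) + ε * ‖u - y‖ := by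
          field_simp
        change _ ≤ r₁ * (1 - r₁⁻¹ * e (u - y) + ε * (r₁⁻¹ * ‖u - y‖)) at h7
        linarith
      have h7 := mul_le_mul_of_nonneg_left h6 (norm_nonneg σ₁.grad)
      have h8 : p (u - y) = ‖p‖ * e (u - y) := by
        conv_lhs => rw [hpe]
        rw [smul_apply, smul_eq_mul]
      have h9 : |‖σ₁.grad‖ - ‖p‖| ≤ κ := (abs_norm_sub_norm_le _ _).trans hp₁
      have h10 : -(κ * ‖u - y‖) ≤ (‖σ₁.grad‖ - ‖p‖) * e (u - y) := by
        refine neg_le_of_abs_le ?_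
        rw [abs_mul]
        refine mul_le_mul h9 ?_ (abs_nonneg _) hκ0.le
        have := e.le_opNorm (u - y)
        rwa [he, one_mul] at this
      have h11 : ‖σ₁.grad‖ * ε ≤ γ / 8 := by
        refine le_trans (mul_le_mul_of_nonneg_right ?_ hε) hεγ
        have := (abs_le.1 h9).2
        linarith
      have h12 := mul_le_mul_of_nonneg_right h11 (norm_nonneg (u - y))
      -- the next step is much shorter than the radius, hence than `‖u - y‖`
      have h13 : ‖u - y‖ ≤ 2 * R := by
        have h14 := h₂.dist_le
        change r₂ ≤ κ * σ₁.radius at h14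
        have h15 := mul_le_mul_of_nonneg_right hκ1 h₁.radius_pos'.le
        linarith
      have h14 : 0 ≤ γ := by linarith
      have h15 := mul_le_mul_of_nonneg_left h13 (show 0 ≤ γ / 8 + 2 * κ by positivity)
      have h16 := mul_le_mul_of_nonneg_right hκ3 hR0
      have h17 : ‖σ₁.grad‖ * (e (u - y) - ε * ‖u - y‖) =
        ‖p‖ * e (u - y) + (‖σ₁.grad‖ - ‖p‖) * e (u - y) - ‖σ₁.grad‖ * ε * ‖u - y‖ := by ring
      linarith
  -- comparison of `y` with `z`
  have hsecond : p (y - z) - γ / 4 * R ≤ F y - F z - η (y - z) := by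
    have h3 := h₂.drop
    have h4 := h₂.grad_apply
    change (‖σ₂.grad‖ - κ) * r₂ ≤ F y - F σ₂.pt - η (y - σ₂.pt) at h3
    change σ₂.grad (y - σ₂.pt) = ‖σ₂.grad‖ * r₂ at h4
    have h5 : σ₂.grad (y - σ₂.pt) - p (y - σ₂.pt) ≥ -(κ * r₂) := by
      have h6 := neg_le_apply (σ₂.grad - p) (y - σ₂.pt)
      rw [sub_apply, norm_sub_rev y] at h6
      have h7 := mul_le_mul_of_nonneg_right hp₂ hr₂.le
      change -(_ * r₂) ≤ _ at h6
      linarith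
    have hzσ : ‖σ₂.pt - z‖ ≤ κ * r₂ := by
      rw [norm_sub_rev]
      exact hz₂.trans h₂.radius_le
    have h6 := hF.sub_le hzC h₂.mem
    rw [norm_sub_rev] at h6
    have h7 := mul_le_mul_of_nonneg_right (le_abs_self ℓ) (norm_nonneg (σ₂.pt - z))
    have h8 := apply_le_opNorm η (σ₂.pt - z)
    have h9 := apply_le_opNorm p (σ₂.pt - z)
    have h10 := mul_le_mul_of_nonneg_left hzσ (show 0 ≤ |ℓ| + ‖η‖ + ‖p‖ by positivity)
    have h11 := mul_le_mul_of_nonneg_left hr₂R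
      (show 0 ≤ κ * (2 + (|ℓ| + ‖η‖) + ‖p‖) by positivity)
    have h12 := mul_le_mul_of_nonneg_right hκ4 hR0
    simp only [map_sub] at *
    linarith
  have h3 : p (u - z) = p (u - y) + p (y - z) := by rw [← map_add, sub_add_sub_cancel]
  have h4 : η (u - z) = η (u - y) + η (y - z) := by rw [← map_add, sub_add_sub_cancel]
  have h5 : 0 ≤ γ / 4 * R := by
    have : 0 ≤ γ := by linarith
    positivity
  linarith

/-- The limit point of a descent with vanishing tolerances and convergent functionals. The points
of the descent show that the limiting direction is tangent, and the ranges of scales covered by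
`subgradient_between_scales` fill a neighbourhood of the limit point. -/
theorem exists_tangent_subgradient [CompleteSpace X] (hrefl : Reflexive X)
    (hX : LocallyUniformlyConvex X) (hX' : LocallyUniformlyConvex (StrongDual ℝ X))
    (hC : IsClosed C) (hF : LipschitzBoundOn ℓ F C) {x : ℕ → ProxState X}
    (hstep : ∀ i, ProxStep F C η (1 / 2) c (x i) (x (i + 1)))
    (hsmall : ∀ τ : ℝ, 0 < τ → ∀ᶠ i in atTop, ProxStep F C η τ c (x i) (x (i + 1)))
    (hlim : Tendsto (fun i => (x i).grad) atTop (𝓝 p)) (hp : p ≠ 0) :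
    ∃ z ∈ C, ‖z - (x 0).pt‖ ≤ (x 0).radius ∧ (∃ v ∈ tangentCone z C, p ∈ dualityMap v) ∧
      ∀ γ : ℝ, 0 < γ → ∃ r : ℝ, 0 < r ∧ ∀ u ∈ C, ‖u - z‖ < r →
        p (u - z) - γ * ‖u - z‖ ≤ F u - F z - η (u - z) := by
  set y : ℕ → X := fun i => (x i).pt
  set ρ : ℕ → ℝ := fun i => (x i).radius
  set r : ℕ → ℝ := fun i => ‖y (i + 1) - y i‖
  have hr : ∀ i, 0 < r i := fun i => (hstep i).norm_sub_pos
  have hrρ : ∀ i, r i ≤ 1 / 2 * ρ i := fun i => (hstep i).dist_le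
  have hρr : ∀ i, ρ (i + 1) ≤ 1 / 2 * r i := fun i => (hstep i).radius_le
  have hstay : ∀ i k, i ≤ k → ‖y k - y i‖ + ρ k ≤ ρ i := by
    intro i k hik
    induction k, hik using Nat.le_induction with
    | base => simp
    | succ k _ ih =>
      have h1 : ‖y (k + 1) - y k‖ + ρ (k + 1) ≤ ρ k := (hstep k).norm_add_radius_le le_rfl
      have h2 := norm_sub_le_norm_sub_add_norm_sub (y (k + 1)) (y k) (y i)
      linarith
  have hρpos : ∀ i, 0 < ρ i := fun i => (hstep i).radius_pos
  have hstay' : ∀ i k, i ≤ k → ‖y k - y i‖ ≤ ρ i := fun i k hik => by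
    have h1 := hstay i k hik
    have h2 := hρpos k
    linarith
  have hρ0 : Tendsto ρ atTop (𝓝 0) := by
    have hgeom : ∀ i, ρ i ≤ ρ 0 * (1 / 2) ^ i := by
      intro i
      induction i with
      | zero => simp
      | succ i ih =>
        have h1 := hrρ i
        have h2 := hρr i
        have h3 := hρpos i
        rw [pow_succ]
        linarith
    refine squeeze_zero (fun i => (hρpos i).le) hgeom ?_
    simpa using (tendsto_pow_atTop_nhds_zero_of_lt_one (by norm_num : (0 : ℝ) ≤ 1 / 2)
      (by norm_num)).const_mul (ρ 0)
  have hr0 : Tendsto r atTop (𝓝 0) := squeeze_zero (fun i => (hr i).le) hrρ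
    (by simpa only [mul_zero] using hρ0.const_mul (1 / 2))
  have hcau : CauchySeq y := by
    refine cauchySeq_of_le_tendsto_0 (fun j => ρ j + ρ j) (fun n m N hn hm => ?_)
      (by simpa using hρ0.add hρ0)
    rw [dist_eq_norm]
    have h1 := hstay' N n hn
    have h2 := hstay' N m hm
    rw [norm_sub_rev] at h2
    have h3 := norm_sub_le_norm_sub_add_norm_sub (y n) (y N) (y m)
    linarith
  obtain ⟨z, hz⟩ := cauchySeq_tendsto_of_complete hcau
  have hzy : ∀ i, ‖z - y i‖ ≤ ρ i := fun i =>
    le_of_tendsto (hz.sub_const _).norm ((eventually_ge_atTop i).mono fun k hk => hstay' i k hk)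
  have hyC : ∀ i, y (i + 1) ∈ C := fun i => (hstep i).mem
  have hzC : z ∈ C := hC.mem_of_tendsto ((tendsto_add_atTop_iff_nat 1).2 hz)
    (Eventually.of_forall hyC)
  -- the directions of the steps converge
  have hp0 : 0 < ‖p‖ := norm_pos_iff.2 hp
  obtain ⟨d, hd, hpd⟩ := hrefl.exists_norming p hp
  set D : ℕ → X := fun i => (r i)⁻¹ • (y i - y (i + 1)) with hD
  have hDn : ∀ i, ‖D i‖ = 1 := fun i => by
    simp only [hD]
    rw [norm_smul, norm_inv, Real.norm_of_nonneg (hr i).le, norm_sub_rev (y i)]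
    exact inv_mul_cancel₀ (hr i).ne'
  have hgD : ∀ i, (x (i + 1)).grad (D i) = ‖(x (i + 1)).grad‖ := fun i => by
    have h1 : (x (i + 1)).grad (y i - y (i + 1)) = ‖(x (i + 1)).grad‖ * r i := (hstep i).grad_apply
    simp only [hD]
    rw [map_smul, h1, smul_eq_mul]
    have := (hr i).ne'
    field_simp
  have hlim1 : Tendsto (fun i => (x (i + 1)).grad) atTop (𝓝 p) :=
    (tendsto_add_atTop_iff_nat 1).2 hlim
  have hgp : ∀ κ : ℝ, 0 < κ → ∀ᶠ i in atTop, ‖(x (i + 1)).grad - p‖ < κ := fun κ hκ => by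
    simpa [dist_eq_norm] using Metric.tendsto_nhds.1 hlim1 κ hκ
  have hDlim : Tendsto D atTop (𝓝 d) := by
    refine hX.tendsto hd hDn fun δ hδ => ?_
    filter_upwards [hgp (‖p‖ * δ / 2) (by positivity)] with i hi
    have h1 := apply_le_opNorm p (d + D i)
    have h2 := neg_le_apply (p - (x (i + 1)).grad) (D i)
    have h3 := norm_sub_norm_le p (x (i + 1)).grad
    rw [norm_sub_rev] at hi
    rw [sub_apply, hDn, mul_one, hgD] at h2
    rw [map_add, hpd] at h1
    refine lt_of_mul_lt_mul_left ?_ hp0.le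
    linarith
  refine ⟨z, hzC, hzy 0, ⟨‖p‖ • d, ?_, ?_⟩, fun γ hγ => ?_⟩
  · -- tangency
    refine ⟨fun i => r (i + 1) / ‖p‖, fun i => (r (i + 1) / ‖p‖)⁻¹ • (y (i + 1) - z),
      fun i => div_pos (hr _) hp0, ?_, ?_, fun i => ?_⟩
    · simpa using ((tendsto_add_atTop_iff_nat 1).2 hr0).div_const ‖p‖
    · have herr : Tendsto (fun i => (r i)⁻¹ • (y (i + 1) - z)) atTop (𝓝 0) := by
        refine Metric.tendsto_nhds.2 fun δ hδ => ?_
        filter_upwards [hsmall (δ / 2) (by positivity)] with i hi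
        have h1 : ρ (i + 1) ≤ δ / 2 * r i := hi.radius_le
        have h2 := hzy (i + 1)
        rw [dist_zero_right, norm_smul, norm_inv, Real.norm_of_nonneg (hr i).le, norm_sub_rev,
          inv_mul_lt_iff₀ (hr i)]
        have h3 := mul_pos hδ (hr i)
        linarith
      have hsum : Tendsto (fun i => ‖p‖ • (D i + (r i)⁻¹ • (y (i + 1) - z))) atTop
          (𝓝 (‖p‖ • d)) := by
        simpa using (hDlim.add herr).const_smul ‖p‖
      refine ((tendsto_add_atTop_iff_nat 1).2 hsum).congr fun i => ?_
      simp only [hD]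
      rw [inv_div, div_eq_mul_inv, mul_smul, ← smul_add]
      congr 2
      abel
    · rw [smul_inv_smul₀ (div_pos (hr _) hp0).ne', add_sub_cancel]
      exact hyC i
  · -- duality
    have hn : ‖‖p‖ • d‖ = ‖p‖ := by rw [norm_smul, hd, mul_one, norm_norm]
    refine ⟨?_, by rw [hn]⟩
    rw [map_smul, hpd, hn, smul_eq_mul, sq]
  · -- the subgradient inequality
    set e := ‖p‖⁻¹ • p with he
    have hen : ‖e‖ = 1 := by rw [norm_smul, norm_inv, norm_norm, inv_mul_cancel₀ hp0.ne']
    have hpe : p = ‖p‖ • e := by rw [he, smul_inv_smul₀ hp0.ne']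
    have hed : e d = 1 := by rw [he, smul_apply, hpd, smul_eq_mul, inv_mul_cancel₀ hp0.ne']
    obtain ⟨τ', hτ', hsm'⟩ := exists_norm_sub_le hX' hd hen hed
      (show 0 < γ / (8 * (‖p‖ + 1)) by positivity)
    set τ := min τ' 1
    have hτ : 0 < τ := by positivity
    obtain ⟨κ, hκ, hκ1, hκ2, hκ3, hκ4, hκ5⟩ : ∃ κ : ℝ, 0 < κ ∧ κ ≤ 1 / 4 ∧ κ ≤ τ / 2 ∧
        2 * κ * (1 + 4 / τ) ≤ γ / 4 ∧ 4 * κ ≤ γ / 4 ∧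
        κ * (2 + (|ℓ| + ‖η‖) + ‖p‖) * (2 / τ) ≤ γ / 4 := by
      set A := 1 + 4 / τ
      set B := (2 + (|ℓ| + ‖η‖) + ‖p‖) * (2 / τ)
      have hA : 0 < A := by positivity
      have hB : 0 < B := by positivity
      let κ := min (min (1 / 4) (τ / 2)) (min (min (γ / (8 * A)) (γ / 16)) (γ / (4 * B)))
      have h1 : κ ≤ γ / (8 * A) :=
        (min_le_right _ _).trans ((min_le_left _ _).trans (min_le_left _ _))
      have h2 : κ ≤ γ / 16 := (min_le_right _ _).trans ((min_le_left _ _).trans (min_le_right _ _))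
      have h3 : κ ≤ γ / (4 * B) := (min_le_right _ _).trans (min_le_right _ _)
      refine ⟨κ, by positivity, (min_le_left _ _).trans (min_le_left _ _),
        (min_le_left _ _).trans (min_le_right _ _), ?_, by linarith, ?_⟩
      · rw [le_div_iff₀ (by positivity)] at h1
        linarith
      · rw [le_div_iff₀ (by positivity)] at h3
        rw [mul_assoc]
        change κ * B ≤ _
        linarith
    have hDτ : ∀ᶠ i in atTop, ‖D i - d‖ < τ := by
      simpa [dist_eq_norm] using Metric.tendsto_nhds.1 hDlim τ hτ
    obtain ⟨m₀, hm₀⟩ := eventually_atTop.1 (((hsmall κ hκ).and (hgp κ hκ)).and hDτ)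
    refine ⟨τ / 2 * r m₀, by have := hr m₀; positivity, fun u huC hu => ?_⟩
    rcases eq_or_ne u z with rfl | huz
    · simp
    have hR : 0 < ‖u - z‖ := norm_pos_iff.2 (sub_ne_zero.2 huz)
    -- `i + 1` is the first index whose scale lies below `‖u - z‖`
    have hex : ∃ k, τ / 2 * r (m₀ + k) < ‖u - z‖ := by
      have h1 : Tendsto (fun k => τ / 2 * r (m₀ + k)) atTop (𝓝 0) := by
        have h2 := hr0.comp (tendsto_atTop_mono (fun k => Nat.le_add_left k m₀) tendsto_id)
        simpa using h2.const_mul (τ / 2)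
      exact (h1.eventually (gt_mem_nhds hR)).exists
    classical
    obtain ⟨k, hk1, hk2⟩ : ∃ k, ‖u - z‖ ≤ τ / 2 * r (m₀ + k) ∧
        τ / 2 * r (m₀ + k + 1) < ‖u - z‖ := by
      have h1 := Nat.find_spec hex
      have h2 : Nat.find hex ≠ 0 := fun h0 => by
        rw [h0] at h1
        exact lt_asymm hu h1
      obtain ⟨k, hk⟩ := Nat.exists_eq_succ_of_ne_zero h2
      refine ⟨k, not_lt.1 (Nat.find_min hex (by omega)), ?_⟩
      rw [hk] at h1
      exact h1
    set i := m₀ + k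
    obtain ⟨⟨hs₁, hg₁⟩, hD₁⟩ := hm₀ i (by omega)
    obtain ⟨⟨hs₂, hg₂⟩, -⟩ := hm₀ (i + 1) (by omega)
    refine subgradient_between_scales hF hs₁ hs₂ hzC huC (hzy _) (hzy _) hg₁.le hg₂.le hen hpe hτ
      (min_le_right _ _) (ε := γ / (8 * (‖p‖ + 1))) (by positivity) (fun h hh => ?_) hk2 hk1 hκ1 hκ2
      hκ3 (le_of_eq (by field_simp)) hκ4 hκ5
    have h1 := hsm' (D i) h (hD₁.le.trans (min_le_left _ _)) (hh.trans (min_le_left _ _))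
    rwa [hDn] at h1

end Limit

section Existence

variable {X : Type*} [NormedAddCommGroup X] [NormedSpace ℝ X]

/-! ### Existence of subgradients in the image of the tangent cone -/

theorem tangentCone_mono {C Ω : Set X} (h : C ⊆ Ω) (z : X) : tangentCone z C ⊆ tangentCone z Ω :=
  fun _ ⟨t, w, ht, ht0, hw, hmem⟩ => ⟨t, w, ht, ht0, hw, fun k => h (hmem k)⟩

/-- Every closed set carrying a Lipschitz function has, near each of its points, points with an
`ε`-subgradient in the duality image of the tangent cone: either some slope is smaller than `ε` and
the zero functional serves, or the limit of the descent sequence does. -/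
theorem exists_subgradient_near [CompleteSpace X] (hrefl : Reflexive X)
    (hX : LocallyUniformlyConvex X) (hX' : LocallyUniformlyConvex (StrongDual ℝ X))
    {F : X → ℝ} {C : Set X} {ℓ : ℝ} (hC : IsClosed C) (hF : LipschitzBoundOn ℓ F C) {x₀ : X}
    (hx₀ : x₀ ∈ C) {ε δ : ℝ} (hε : 0 < ε) (hδ : 0 < δ) :
    ∃ z ∈ C, ‖z - x₀‖ ≤ δ ∧ ∃ p : StrongDual ℝ X, (∃ v ∈ tangentCone z C, p ∈ dualityMap v) ∧
      ∃ r : ℝ, 0 < r ∧ ∀ u ∈ C, ‖u - z‖ < r → p (u - z) - ε * ‖u - z‖ ≤ F u - F z := by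
  by_cases hslope : ∀ z ∈ C, ‖z - x₀‖ ≤ δ → ε ≤ descentSlope F C 0 z
  · obtain ⟨x, η, p, c, hη, hx0, hx0r, hstep, hsmall, hlim, hp⟩ :=
      exists_descent_sequence hrefl hX hX' hC hF hε hslope hx₀ hδ
    obtain ⟨z, hzC, hz, htan, hsub⟩ :=
      exists_tangent_subgradient hrefl hX hX' hC hF hstep hsmall hlim hp
    rw [hx0, hx0r] at hz
    obtain ⟨r, hr, hsub⟩ := hsub (ε / 2) (by positivity)
    refine ⟨z, hzC, hz, p, htan, r, hr, fun u hu hur => ?_⟩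
    have h1 := hsub u hu hur
    have h2 := neg_le_apply η (u - z)
    have h3 := mul_le_mul_of_nonneg_right hη (norm_nonneg (u - z))
    have h4 : 0 ≤ ε * ‖u - z‖ := by positivity
    linarith
  · push Not at hslope
    obtain ⟨z, hzC, hz, hlt⟩ := hslope
    obtain ⟨-, r, hr, hb⟩ := hF.hasSlopeBound_of_lt hzC hlt
    refine ⟨z, hzC, hz, 0, ⟨0, ⟨fun k => 1 / ((k : ℝ) + 1), fun _ => 0,
      fun k => Nat.one_div_pos_of_nat, tendsto_one_div_add_atTop_nhds_zero_nat,
      tendsto_const_nhds, fun k => by simpa using hzC⟩, by simp [dualityMap]⟩, r, hr,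
      fun u hu hur => ?_⟩
    have := hb u hu hur
    simp only [zero_apply] at this ⊢
    linarith

/-- An `ε`-subgradient of an `ℓ`-Lipschitz function in the duality image of the tangent cone has
norm at most `ℓ + ε`, as is seen by testing it in the corresponding tangent direction. -/
theorem norm_le_of_subgradient {F : X → ℝ} {C : Set X} {ℓ ε r : ℝ} (hF : LipschitzBoundOn ℓ F C)
    (hℓ : 0 ≤ ℓ) (hε : 0 ≤ ε) {z v : X} {p : StrongDual ℝ X} (hz : z ∈ C) (hv : v ∈ tangentCone z C)
    (hp : p ∈ dualityMap v) (hr : 0 < r)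
    (hsub : ∀ u ∈ C, ‖u - z‖ < r → p (u - z) - ε * ‖u - z‖ ≤ F u - F z) : ‖p‖ ≤ ℓ + ε := by
  obtain ⟨t, w, ht, ht0, hw, hmem⟩ := hv
  obtain ⟨hpv, hvp⟩ := hp
  have hnorm : ‖v‖ = ‖p‖ := (sq_eq_sq₀ (norm_nonneg _) (norm_nonneg _)).1 hvp
  have hev : ∀ᶠ k in atTop, p (w k) ≤ (ℓ + ε) * ‖w k‖ := by
    have h1 : Tendsto (fun k => ‖t k • w k‖) atTop (𝓝 0) := by
      simpa using (ht0.smul hw).norm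
    filter_upwards [h1.eventually (gt_mem_nhds hr)] with k hk
    have h2 := hsub _ (hmem k) (by simpa using hk)
    have h3 := hF.sub_le (hmem k) hz
    rw [add_sub_cancel_left, norm_smul, Real.norm_of_nonneg (ht k).le] at h2 h3
    rw [map_smul, smul_eq_mul] at h2
    refine le_of_mul_le_mul_left ?_ (ht k)
    linarith
  have hlim := le_of_tendsto_of_tendsto ((p.continuous.tendsto v).comp hw)
    (hw.norm.const_mul (ℓ + ε)) hev
  rw [hpv, hnorm] at hlim
  rcases (norm_nonneg p).eq_or_lt with h0 | h0
  · rw [← h0]; positivity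
  · rw [sq] at hlim
    exact le_of_mul_le_mul_right hlim h0

/-! ### Geometric subdifferentials -/

theorem pairFunctional_apply (p : StrongDual ℝ X) (s : ℝ) (w : WithLp 1 (X × ℝ)) :
    pairFunctional p s w = p w.fst + s * w.snd := rfl

/-- A local `ε`-subgradient inequality on `Ω` gives an `ε`-normal to the epigraph. -/
theorem mem_geomSubdiff_restrict {f : X → EReal} {Ω : Set X} {z : X} {p : StrongDual ℝ X}
    {ε r : ℝ} (hε : 0 ≤ ε) (hz : z ∈ Ω) (hr : 0 < r)
    (hfin : ∀ u ∈ Ω, ‖u - z‖ < r → FiniteAt f u)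
    (hsub : ∀ u ∈ Ω, ‖u - z‖ < r →
      p (u - z) - ε * ‖u - z‖ ≤ (f u).toReal - (f z).toReal) :
    p ∈ geomSubdiff ε (restrict f Ω) z := by
  have hres : restrict f Ω z = f z := if_pos hz
  have hfz : FiniteAt f z := hfin z hz (by simpa using hr)
  refine ⟨by unfold FiniteAt; rwa [hres], ?_⟩
  rw [hres]
  set z' : WithLp 1 (X × ℝ) := WithLp.toLp 1 (z, (f z).toReal)
  change limsup (fun w : WithLp 1 (X × ℝ) =>
    ((pairFunctional p (-1) (w - z') / ‖w - z'‖ : ℝ) : EReal)) _ ≤ _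
  refine limsup_le_of_le (h := ?_)
  have hball : ∀ᶠ w in 𝓝[epi (restrict f Ω) \ {z'}] z', ‖w - z'‖ < r := by
    refine nhdsWithin_le_nhds ?_
    filter_upwards [Metric.ball_mem_nhds z' hr] with w hw using mem_ball_iff_norm.1 hw
  filter_upwards [hball, self_mem_nhdsWithin] with w hw hwepi
  have hnorm : ‖w - z'‖ = ‖w.fst - z‖ + |w.snd - (f z).toReal| :=
    WithLp.prod_norm_eq_of_L1 (w - z')
  have hle : restrict f Ω w.fst ≤ (w.snd : EReal) := hwepi.1
  have hΩ : w.fst ∈ Ω := by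
    by_contra hn
    have h1 : restrict f Ω w.fst = ⊤ := if_neg hn
    rw [h1, top_le_iff] at hle
    exact EReal.coe_ne_top _ hle
  have hdist : ‖w.fst - z‖ < r := by
    have := abs_nonneg (w.snd - (f z).toReal)
    linarith
  have hfw := hfin _ hΩ hdist
  have h2 : restrict f Ω w.fst = f w.fst := if_pos hΩ
  rw [h2, ← EReal.coe_toReal hfw.1 hfw.2, EReal.coe_le_coe_iff] at hle
  have h3 := hsub _ hΩ hdist
  refine EReal.coe_le_coe_iff.2 (div_le_of_le_mul₀ (norm_nonneg _) hε ?_)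
  rw [pairFunctional_apply, hnorm]
  change p (w.fst - z) + -1 * (w.snd - (f z).toReal) ≤ _
  have h4 : 0 ≤ ε * |w.snd - (f z).toReal| := by positivity
  linarith

end Existence

end RelSubdiff

theorem theorem3p1 {X : Type*} [NormedAddCommGroup X] [NormedSpace ℝ X] [CompleteSpace X]
    (hrefl : RelSubdiff.Reflexive X)
    (hX : RelSubdiff.LocallyUniformlyConvex X)
    (hX' : RelSubdiff.LocallyUniformlyConvex (StrongDual ℝ X))
    (hnorm : ∀ x : X, x ≠ 0 → DifferentiableAt ℝ (fun u : X => ‖u‖) x)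
    (f : X → EReal) (Ω : Set X) (xbar : X)
    (hlsc : RelSubdiff.LscRelativeTo f Ω)
    (hxbar : xbar ∈ Ω ∩ RelSubdiff.dom f)
    (hΩ : RelSubdiff.LocallyClosedAround Ω xbar)
    (hlip : RelSubdiff.LocallyLipschitzRelativeTo f Ω xbar) :
    (RelSubdiff.limSubdiff f Ω xbar).Nonempty := by
  obtain ⟨V, hV, -, hΩV⟩ := hΩ
  obtain ⟨ℓ, hℓ, U, hU, hfin, hLip⟩ := hlip
  obtain ⟨R, hR, hball⟩ := Metric.nhds_basis_closedBall.mem_iff.1 (inter_mem hV hU)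
  set C := Ω ∩ Metric.closedBall xbar R
  have hCeq : C = (Ω ∩ V) ∩ Metric.closedBall xbar R := by
    ext u
    exact ⟨fun h => ⟨⟨h.1, (hball h.2).1⟩, h.2⟩, fun h => ⟨h.1.1, h.2⟩⟩
  have hC : IsClosed C := by
    rw [hCeq]
    exact hΩV.inter Metric.isClosed_closedBall
  have hCU : ∀ u ∈ C, u ∈ U ∩ Ω := fun u hu => ⟨(hball hu.2).2, hu.1⟩
  have hF : RelSubdiff.LipschitzBoundOn ℓ (fun u => (f u).toReal) C := fun u hu v hv =>
    hLip u (hCU u hu) v (hCU v hv)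
  have hxC : xbar ∈ C := ⟨hxbar.1, Metric.mem_closedBall_self hR.le⟩
  have hε : ∀ k : ℕ, (0 : ℝ) < 1 / ((k : ℝ) + 1) := fun k => Nat.one_div_pos_of_nat
  have hε0 : Tendsto (fun k : ℕ => 1 / ((k : ℝ) + 1)) atTop (𝓝 0) :=
    tendsto_one_div_add_atTop_nhds_zero_nat
  have hεanti : Antitone fun k : ℕ => 1 / ((k : ℝ) + 1) := fun a b hab =>
    Nat.one_div_le_one_div hab
  choose z hzC hz p htan r hr hsub using fun k : ℕ =>
    RelSubdiff.exists_subgradient_near hrefl hX hX' hC hF hxC (hε k)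
      (show 0 < R / 2 * (1 / ((k : ℝ) + 1)) from mul_pos (by positivity) (hε k))
  choose v hv hpv using htan
  have hzR : ∀ k, ‖z k - xbar‖ ≤ R / 2 := fun k => (hz k).trans (by
    have h1 : 1 / ((k : ℝ) + 1) ≤ 1 / ((0 : ℕ) + 1) := hεanti (Nat.zero_le k)
    have h2 := mul_le_mul_of_nonneg_left h1 (show 0 ≤ R / 2 by positivity)
    simpa using h2)
  have hzlim : Tendsto z atTop (𝓝 xbar) := by
    rw [tendsto_iff_norm_sub_tendsto_zero]
    exact squeeze_zero (fun k => norm_nonneg _) hz (by simpa using hε0.const_mul (R / 2))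
  have hpn : ∀ k, ‖p k‖ ≤ ℓ + 1 := fun k => by
    have h1 := RelSubdiff.norm_le_of_subgradient hF hℓ (hε k).le (hzC k) (hv k) (hpv k) (hr k)
      (hsub k)
    have h2 : 1 / ((k : ℝ) + 1) ≤ 1 / ((0 : ℕ) + 1) := hεanti (Nat.zero_le k)
    simp only [Nat.cast_zero, zero_add, div_one] at h2
    linarith
  obtain ⟨q, φ, hφ, hq⟩ := hrefl.exists_subseq_tendsto hpn
  have hflim : Tendsto (fun k => f (z k)) atTop (𝓝 (f xbar)) := by
    have h1 : ∀ u ∈ C, f u = ((f u).toReal : EReal) := fun u hu =>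
      (EReal.coe_toReal (hfin u (hCU u hu)).1 (hfin u (hCU u hu)).2).symm
    rw [h1 xbar hxC]
    have h2 : Tendsto (fun k => (f (z k)).toReal) atTop (𝓝 (f xbar).toReal) :=
      (hF.continuousOn xbar hxC).tendsto.comp
        (tendsto_nhdsWithin_iff.2 ⟨hzlim, Eventually.of_forall hzC⟩)
    exact ((continuous_coe_real_ereal.tendsto _).comp h2).congr fun k => (h1 _ (hzC k)).symm
  have hreg : ∀ n : ℕ, p n ∈ RelSubdiff.regSubdiff (1 / ((n : ℝ) + 1)) f Ω (z n) := fun n => by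
    have hloc : ∀ u ∈ Ω, ‖u - z n‖ < min (r n) (R / 2) → u ∈ C := fun u hu hur => ⟨hu, by
      rw [mem_closedBall_iff_norm]
      have h1 := hzR n
      have h2 := norm_sub_le_norm_sub_add_norm_sub u (z n) xbar
      have h3 := hur.trans_le (min_le_right _ _)
      linarith⟩
    refine ⟨(hzC n).1, hfin _ (hCU _ (hzC n)),
      RelSubdiff.mem_geomSubdiff_restrict (r := min (r n) (R / 2)) (hε n).le (hzC n).1
        (lt_min (hr n) (by positivity)) (fun u hu hur => hfin u (hCU u (hloc u hu hur)))
        (fun u hu hur => hsub n u (hloc u hu hur) (hur.trans_le (min_le_left _ _))),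
      v n, RelSubdiff.tangentCone_mono Set.inter_subset_left _ (hv n), hpv n⟩
  refine ⟨q, hxbar.1, hfin _ (hCU _ hxC), fun k => 1 / ((φ k : ℝ) + 1), z ∘ φ, p ∘ φ,
    fun k => hε _, fun a b hab => hεanti (hφ.monotone hab), hε0.comp hφ.tendsto_atTop,
    fun k => (hzC _).1, hzlim.comp hφ.tendsto_atTop, hflim.comp hφ.tendsto_atTop, hq,
    fun k => hreg (φ k)⟩
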